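/- **Setting.** A *partition* of a set is a set of disjoint nonempty blocks covering it. A *link type* $\langle n,m,\mathfrak B\rangle$ consists of $n,m\in\mathbb N$ and a set $\mathfrak B$ of partitions of $\{\mathsf i_1,\dots,\mathsf i_n,\mathsf o_1,\dots,\mathsf o_m\}$. A *multiplicative structure* is a finite directed hypergraph whose hyperedges (links) are labelled by link types, with inputs and outputs as prescribed by the type, and which is *linear*: each vertex occurs at most once as an input of a link and at most once as an output of a link, and not both in the same link. Its *inputs* (resp. *outputs*) are the vertices that are not an output (resp. input) of any link; its *border* $\partial\mathcal M$ is the set of its inputs and outputs. A *switching* $\sigma$ chooses for every link a partition in its behavior; the *test* $\sigma(\mathcal M)$ is the undirected hypergraph (parallel hyperedges allowed) obtained by replacing each link by one hyperedge for each block of the chosen partition. The *behavior* $\mathrm{beh}(\mathcal M)$ is the set of partitions of the border induced by connectedness in the tests. $\mathcal M$ is a *component* if every test is acyclic and each vertex is connected, in every test, to a border vertex. Let $X$ be a nonempty set of inputs of $\mathcal M$ identified bijectively with outputs of $\mathcal M'$ (all other vertices being distinct). For components $\mathcal M,\mathcal M'$, *$\mathcal M'$ expands $\mathcal M$ on $X$*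 if the structure obtained by gluing $\mathcal M$ and $\mathcal M'$ along $X$ is a component. For partitions $p,q$ of a set $Y$, $\mathcal G(p,q)$ is the multigraph whose vertices are the blocks of $p$ and the blocks of $q$ (taken disjointly), with one edge for each $i\in Y$, joining the block of $i$ in $p$ to the block of $i$ in $q$; $p\perp_w q$ (*weak orthogonality*) means that $\mathcal G(p,q)$ is acyclic. **Computation.** The machine is a random access machine with unit-cost addition, truncated subtraction, constants, loads, stores, and reads of read-only input arrays, with sequencing, conditionals and while loops; each instruction and each evaluation of a condition counts one step. $\mathcal M$ and $\mathcal M'$ are given by tables of their borders (which border vertices are inputs, which are outputs) and of their behaviors (for each partition and each border vertex, the number of its block and the size of that block), in any enumeration of the border vertices and of the partitions and any numbering of the blocks by numbers smaller than the number of border vertices; $X$ is given by the list of the positions of its elements in the two borders. **Proposition.** 1. There are one program and one polynomial $f$ such that, for all components $\mathcal M,\mathcal M'$, all $X$ and all such tables, the program decides whether $\mathcal M'$ expands $\mathcal M$ on $X$ within $f\big(|\mathrm{outputs}(\mathcal M')|+|\mathrm{beh}(\mathcal M')|+|\mathrm{beh}(\mathcal M)|\big)$ steps, where $|\cdot|$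 is cardinality. 2. For all components $\mathcal M,\mathcal M'$ and all $X$, $\mathcal M'$ expands $\mathcal M$ on $X$ if and only if for all $p\in\mathrm{beh}(\mathcal M)$ and $q\in\mathrm{beh}(\mathcal M')$ the restrictions satisfy $p|_X\perp_w q|_X$ and, moreover, every connected component of $\mathcal G(p|_X,q|_X)$ contains an edge $x\in X$ such that $x$ is an output of $\mathcal M$, or $x$ is an input of $\mathcal M'$, or $x$ is in the same block of $p$ as an element of $\partial\mathcal M\setminus X$, or in the same block of $q$ as an element of $\partial\mathcal M'\setminus X$. Each graph $\mathcal G(p|_X,q|_X)$ has at most $3\,|\mathrm{outputs}(\mathcal M')|$ vertices and edges in total. -/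

import Mathlib

/-! ### Undirected hypergraphs -/

/-- An undirected hypergraph with vertex set `V` and a family of hyperedges indexed by `E`;
`inc e` is the set of vertices of the hyperedge `e`.  Hyperedges are indexed, so two distinct
hyperedges may have the same vertices (parallel hyperedges); a (multi)graph is the case where every
hyperedge has two vertices. -/
structure UHypergraph (V E : Type*) where
  inc : E → Set V

namespace UHypergraph

variable {V E : Type*}

/-- The bipartite graph of incidences between vertices and hyperedges.  Its paths are the
alternating sequences of vertices and hyperedges, each incident with the next. -/
def incidence (G : UHypergraph V E) : SimpleGraph (V ⊕ E) :=
  SimpleGraph.fromRel fun a b => ∃ v e, v ∈ G.inc e ∧ a = Sum.inl v ∧ b = Sum.inr e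

/-- Two vertices are connected if there is a path from one to the other. -/
def Connected (G : UHypergraph V E) (u v : V) : Prop :=
  G.incidence.Reachable (Sum.inl u) (Sum.inl v)

/-- No cyclic alternating sequence of pairwise distinct vertices and pairwise distinct hyperedges
(of length at least two). -/
def Acyclic (G : UHypergraph V E) : Prop :=
  G.incidence.IsAcyclic

/-- Number of vertices plus number of hyperedges. -/
noncomputable def size (_G : UHypergraph V E) : ℕ :=
  Nat.card V + Nat.card E

end UHypergraph

/-! ### Partitions

A partition of `α` is given by its equivalence relation, a `Setoid α`; its blocks are the elements
of the quotient. -/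

/-- The graph of incidence of two partitions `p`, `q` of `α`: the vertices are the blocks of `p` and
the blocks of `q`, and every `i : α` is an edge between its block in `p` and its block in `q`. -/
def incidenceGraph {α : Type*} (p q : Setoid α) : UHypergraph (Quotient p ⊕ Quotient q) α where
  inc i := {Sum.inl (Quotient.mk p i), Sum.inr (Quotient.mk q i)}

/-- `p` and `q` are weakly orthogonal if their graph of incidence is acyclic. -/
def WeakOrth {α : Type*} (p q : Setoid α) : Prop :=
  (incidenceGraph p q).Acyclic

/-! ### Multiplicative structures -/

/-- A link type: `n` inputs, `m` outputs, and a behavior, which is a set of partitions of the set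
`{i_1, …, i_n, o_1, …, o_m}`. -/
structure LinkType where
  n : ℕ
  m : ℕ
  beh : Set (Setoid (Fin n ⊕ Fin m))

/-- A directed hypergraph with vertex set `V` whose hyperedges (links, indexed by `L`) are labelled
by link types; `src l` lists the inputs of the link `l`, and `tgt l` its outputs. -/
structure MStr (V L : Type*) where
  type : L → LinkType
  src : (l : L) → Fin (type l).n → V
  tgt : (l : L) → Fin (type l).m → V

namespace MStr

variable {V L V' L' : Type*}

/-- The vertex at a given input or output position of a link. -/
def at' (M : MStr V L) (l : L) : Fin (M.type l).n ⊕ Fin (M.type l).m → V :=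
  Sum.elim (M.src l) (M.tgt l)

/-- Every vertex occurs at most once as an input of a link and at most once as an output of a link,
and the two links are then distinct. -/
structure IsLinear (M : MStr V L) : Prop where
  src_inj : ∀ l i l' i', M.src l i = M.src l' i' →
    (⟨l, i⟩ : Σ l, Fin (M.type l).n) = ⟨l', i'⟩
  tgt_inj : ∀ l i l' i', M.tgt l i = M.tgt l' i' →
    (⟨l, i⟩ : Σ l, Fin (M.type l).m) = ⟨l', i'⟩
  src_ne_tgt : ∀ l i j, M.src l i ≠ M.tgt l j

/-- An input of the structure: a vertex which is not an output of any link. -/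
def IsInput (M : MStr V L) (v : V) : Prop := ∀ l j, M.tgt l j ≠ v

/-- An output of the structure: a vertex which is not an input of any link. -/
def IsOutput (M : MStr V L) (v : V) : Prop := ∀ l i, M.src l i ≠ v

def inputs (M : MStr V L) : Set V := {v | M.IsInput v}

def outputs (M : MStr V L) : Set V := {v | M.IsOutput v}

def border (M : MStr V L) : Set V := M.inputs ∪ M.outputs

/-- A switching chooses a partition in the behavior of every link. -/
def Switching (M : MStr V L) : Type _ := (l : L) → (M.type l).beh

/-- The test of a switching: every link is replaced by one hyperedge for each block of the chosen
partition. -/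
def test (M : MStr V L) (σ : M.Switching) : UHypergraph V (Σ l, Quotient (σ l).1) where
  inc e := {v | ∃ x, Quotient.mk (σ e.1).1 x = e.2 ∧ M.at' e.1 x = v}

/-- The behavior of a test: the partition of the border by connectedness in the test. -/
def testPartition (M : MStr V L) (σ : M.Switching) : Setoid M.border where
  r x y := (M.test σ).Connected x y
  iseqv := ⟨fun _ => SimpleGraph.Reachable.refl _, fun h => h.symm, fun h h' => h.trans h'⟩

/-- The behavior of the structure: the set of the behaviors of its tests. -/
def beh (M : MStr V L) : Set (Setoid M.border) := Set.range M.testPartition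

/-- A component: a linear structure all of whose tests are acyclic and have every vertex connected
to a vertex of the border. -/
structure IsComponent (M : MStr V L) : Prop where
  linear : M.IsLinear
  acyclic : ∀ σ, (M.test σ).Acyclic
  connected : ∀ σ v, ∃ b ∈ M.border, (M.test σ).Connected v b

end MStr

/-! ### Composition and expansion -/

/-- A nonempty interface `X` for composing `M` with `M'`: `k` inputs `g 0, …, g (k-1)` of `M` that
are to be identified with `k` outputs `h 0, …, h (k-1)` of `M'`. -/
structure Interface {V L V' L' : Type*} (M : MStr V L) (M' : MStr V' L') where
  k : ℕ
  k_pos : 0 < k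
  g : Fin k ↪ V
  h : Fin k ↪ V'
  g_mem : ∀ j, g j ∈ M.inputs
  h_mem : ∀ j, h j ∈ M'.outputs

namespace Interface

variable {V L V' L' : Type*} {M : MStr V L} {M' : MStr V' L'} (X : Interface M M')

/-- The vertices of the composition: those of `M`, and those of `M'` that are not identified with a
vertex of `M`. -/
abbrev Vertex : Type _ := V ⊕ {w : V' // w ∉ Set.range X.h}

open Classical in
/-- How a vertex of `M'` is seen in the composition: `h j` becomes `g j`. -/
noncomputable def right (w : V') : X.Vertex :=
  if hw : w ∈ Set.range X.h then Sum.inl (X.g hw.choose) else Sum.inr ⟨w, hw⟩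

/-- The composition of `M` and `M'` via `X`: their disjoint union, where `g j` and `h j` are
identified for every `j`. -/
noncomputable def comp : MStr X.Vertex (L ⊕ L') where
  type := Sum.elim M.type M'.type
  src
    | Sum.inl l, i => Sum.inl (M.src l i)
    | Sum.inr l, i => X.right (M'.src l i)
  tgt
    | Sum.inl l, i => Sum.inl (M.tgt l i)
    | Sum.inr l, i => X.right (M'.tgt l i)

/-- `M'` expands `M` on `X` (for components `M` and `M'`): the composition is a component. -/
def Expands : Prop := X.comp.IsComponent

/-- The interface as vertices of the border of `M`. -/
def left' (j : Fin X.k) : M.border := ⟨X.g j, Or.inl (X.g_mem j)⟩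

/-- The interface as vertices of the border of `M'`. -/
def right' (j : Fin X.k) : M'.border := ⟨X.h j, Or.inr (X.h_mem j)⟩

/-- The restriction to `X` of a partition of the border of `M`. -/
def restrictLeft (p : Setoid M.border) : Setoid (Fin X.k) := p.comap X.left'

/-- The restriction to `X` of a partition of the border of `M'`. -/
def restrictRight (q : Setoid M'.border) : Setoid (Fin X.k) := q.comap X.right'

/-- The graph of incidence of the restrictions to `X` of `p` and `q`. -/
def restrictedGraph (p : Setoid M.border) (q : Setoid M'.border) :
    UHypergraph (Quotient (X.restrictLeft p) ⊕ Quotient (X.restrictRight q)) (Fin X.k) :=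
  incidenceGraph (X.restrictLeft p) (X.restrictRight q)

/-- The `j`-th vertex of `X` is on the border of the composition (it has no link on one of its two
sides), or it is in one block of `p` or of `q` with a border vertex that is not in `X`. -/
def Escapes (p : Setoid M.border) (q : Setoid M'.border) (j : Fin X.k) : Prop :=
  X.g j ∈ M.outputs ∨ X.h j ∈ M'.inputs ∨
    (∃ y : M.border, (y : V) ∉ Set.range X.g ∧ p (X.left' j) y) ∨
    (∃ z : M'.border, (z : V') ∉ Set.range X.h ∧ q (X.right' j) z)

/-- Every connected component of the graph of incidence of the restrictions of `p` and `q` to `X`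
has an edge `j` that escapes. -/
def Anchored (p : Setoid M.border) (q : Setoid M'.border) : Prop :=
  ∀ i : Fin X.k, ∃ j : Fin X.k, X.Escapes p q j ∧
    (X.restrictedGraph p q).Connected
      (Sum.inl (Quotient.mk _ i)) (Sum.inl (Quotient.mk _ j))

end Interface

/-! ### A random access machine with a step count -/

/-- Programs of a random access machine with registers, a work memory and finitely many read-only
input arrays. -/
inductive Cmd : Type
  /-- `R[d] := n` -/
  | const (d n : ℕ)
  /-- `R[d] := R[a] + R[b]` -/
  | add (d a b : ℕ)
  /-- `R[d] := R[a] - R[b]` (truncated at `0`) -/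
  | sub (d a b : ℕ)
  /-- `R[d] := W[R[a]]` -/
  | load (d a : ℕ)
  /-- `W[R[a]] := R[b]` -/
  | store (a b : ℕ)
  /-- `R[d] :=` the entry with index `R[a]` of the input array number `A`, `0` if there is none -/
  | read (A d a : ℕ)
  | seq (c c' : Cmd)
  /-- if `R[a] ≠ 0` then `c` else `c'` -/
  | cond (a : ℕ) (c c' : Cmd)
  /-- while `R[a] ≠ 0` do `c` -/
  | loop (a : ℕ) (c : Cmd)

/-- Contents of the registers and of the work memory. -/
structure RamState where
  reg : ℕ → ℕ
  mem : ℕ → ℕ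

namespace RamState

def setReg (s : RamState) (d x : ℕ) : RamState := { s with reg := Function.update s.reg d x }

def setMem (s : RamState) (i x : ℕ) : RamState := { s with mem := Function.update s.mem i x }

/-- The initial state: all registers and all memory cells hold `0`. -/
def init : RamState := ⟨fun _ => 0, fun _ => 0⟩

end RamState

/-- `Exec I c s t s'`: on the input arrays `I`, the program `c` started in the state `s` halts in the
state `s'` after exactly `t` steps.  Every elementary instruction and every evaluation of a condition
is one step. -/
inductive Exec (I : List (List ℕ)) : Cmd → RamState → ℕ → RamState → Prop
  | const (d n s) : Exec I (.const d n) s 1 (s.setReg d n)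
  | add (d a b s) : Exec I (.add d a b) s 1 (s.setReg d (s.reg a + s.reg b))
  | sub (d a b s) : Exec I (.sub d a b) s 1 (s.setReg d (s.reg a - s.reg b))
  | load (d a s) : Exec I (.load d a) s 1 (s.setReg d (s.mem (s.reg a)))
  | store (a b s) : Exec I (.store a b) s 1 (s.setMem (s.reg a) (s.reg b))
  | read (A d a s) : Exec I (.read A d a) s 1 (s.setReg d ((I.getD A []).getD (s.reg a) 0))
  | seq {c c' s t s' t' s''} : Exec I c s t s' → Exec I c' s' t' s'' →
      Exec I (.seq c c') s (t + t') s''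
  | cond_true {a c c' s t s'} : s.reg a ≠ 0 → Exec I c s t s' →
      Exec I (.cond a c c') s (1 + t) s'
  | cond_false {a c c' s t s'} : s.reg a = 0 → Exec I c' s t s' →
      Exec I (.cond a c c') s (1 + t) s'
  | loop_done {a c s} : s.reg a = 0 → Exec I (.loop a c) s 1 s
  | loop_step {a c s t s' t' s''} : s.reg a ≠ 0 → Exec I c s t s' →
      Exec I (.loop a c) s' t' s'' → Exec I (.loop a c) s (1 + t + t') s''

/-- The machine is deterministic: the running time and the final state are functions of the program,
the input and the initial state. -/
theorem Exec.deterministic {I : List (List ℕ)} {c : Cmd} {s : RamState} {t : ℕ} {s' : RamState}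
    (h : Exec I c s t s') : ∀ {t₂ : ℕ} {s₂ : RamState}, Exec I c s t₂ s₂ → t = t₂ ∧ s' = s₂ := by
  induction h with
  | const | add | sub | load | store | read => intro t₂ s₂ h₂; cases h₂; exact ⟨rfl, rfl⟩
  | seq _ _ ih ih' =>
    intro t₂ s₂ h₂
    cases h₂ with
    | seq k k' =>
      obtain ⟨rfl, rfl⟩ := ih k
      obtain ⟨rfl, rfl⟩ := ih' k'
      exact ⟨rfl, rfl⟩
  | cond_true h0 _ ih =>
    intro t₂ s₂ h₂
    cases h₂ with
    | cond_true _ k => obtain ⟨rfl, rfl⟩ := ih k; exact ⟨rfl, rfl⟩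
    | cond_false k0 _ => exact absurd k0 h0
  | cond_false h0 _ ih =>
    intro t₂ s₂ h₂
    cases h₂ with
    | cond_true k0 _ => exact absurd h0 k0
    | cond_false _ k => obtain ⟨rfl, rfl⟩ := ih k; exact ⟨rfl, rfl⟩
  | loop_done h0 =>
    intro t₂ s₂ h₂
    cases h₂ with
    | loop_done _ => exact ⟨rfl, rfl⟩
    | loop_step k0 _ _ => exact absurd h0 k0
  | loop_step h0 _ _ ih ih' =>
    intro t₂ s₂ h₂
    cases h₂ with
    | loop_done k0 => exact absurd k0 h0
    | loop_step _ k k' =>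
      obtain ⟨rfl, rfl⟩ := ih k
      obtain ⟨rfl, rfl⟩ := ih' k'
      exact ⟨rfl, rfl⟩

/-! ### Components and interfaces as inputs of the machine -/

/-- A tabulation of the border and of the behavior of a structure: an enumeration of the border, an
enumeration without repetition of the partitions in the behavior, and a numbering of the blocks of
each of these partitions. -/
structure Tabulation {V L : Type*} (M : MStr V L) where
  n : ℕ
  a : ℕ
  vertex : Fin n ≃ M.border
  row : Fin a ≃ M.beh
  label : Fin a → Fin n → Fin n
  label_eq_iff : ∀ r x y, label r x = label r y ↔ (row r).1 (vertex x) (vertex y)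

namespace Tabulation

variable {V L V' L' : Type*} {M : MStr V L} {M' : MStr V' L'}

/-- The number of elements of the block of a border vertex in a partition of the behavior. -/
noncomputable def blockSize (T : Tabulation M) (r : Fin T.a) (x : Fin T.n) : ℕ :=
  Nat.card {y : M.border // (row T r).1 (T.vertex x) y}

open Classical in
/-- Five arrays that describe the border and the behavior of a structure: the numbers of border
vertices and of partitions; for each border vertex, whether it is an input and whether it is an
output of the structure; and (row by row, at index `r * n + x`) for each partition `r` and each
border vertex `x`, the number of the block of `x` and the number of elements of that block. -/
noncomputable def arrays (T : Tabulation M) : List (List ℕ) :=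
  [ [T.n, T.a],
    List.ofFn fun x : Fin T.n => if (T.vertex x : V) ∈ M.inputs then 1 else 0,
    List.ofFn fun x : Fin T.n => if (T.vertex x : V) ∈ M.outputs then 1 else 0,
    List.ofFn fun z : Fin (T.a * T.n) => (T.label z.divNat z.modNat : ℕ),
    List.ofFn fun z : Fin (T.a * T.n) => T.blockSize z.divNat z.modNat ]

/-- The input of the machine: the size of the interface, the positions of its vertices in the
borders of `M` and of `M'`, and the tables of `M` and of `M'`. -/
noncomputable def input (T : Tabulation M) (T' : Tabulation M') (X : Interface M M') :
    List (List ℕ) :=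
  [ [X.k],
    List.ofFn fun j => (T.vertex.symm (X.left' j) : ℕ),
    List.ofFn fun j => (T'.vertex.symm (X.right' j) : ℕ) ] ++ T.arrays ++ T'.arrays

/-- Every finite structure has a tabulation. -/
theorem nonempty [Finite V] (M : MStr V L) : Nonempty (Tabulation M) := by
  have : Finite (Setoid M.border) :=
    Finite.of_injective (fun p : Setoid M.border => (p : M.border → M.border → Prop))
      (fun p q h => Setoid.ext fun x y => by
        have := congrFun (congrFun h x) y
        exact iff_of_eq this)
  let e := (Finite.equivFin M.border).symm
  let f := (Finite.equivFin M.beh).symm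
  refine ⟨⟨_, _, e, f, fun r x => e.symm (Quotient.mk (f r).1 (e x)).out, fun r x y => ?_⟩⟩
  rw [e.symm.injective.eq_iff]
  constructor
  · intro h
    have := congrArg (Quotient.mk (f r).1) h
    rw [Quotient.out_eq, Quotient.out_eq] at this
    exact Quotient.exact this
  · intro h
    exact congrArg Quotient.out (Quotient.sound (s := (f r).1) h)

end Tabulation

/-- On the input arrays `I`, the program `P` halts within `t` steps, with `1` in register `0` if `Q`
holds and with `0` in register `0` otherwise. -/
def DecidesWithin (P : Cmd) (I : List (List ℕ)) (t : ℕ) (Q : Prop) : Prop :=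
  ∃ t' s, t' ≤ t ∧ Exec I P RamState.init t' s ∧
    (Q → s.reg 0 = 1) ∧ (¬ Q → s.reg 0 = 0)

/-!
The criterion for expansion is a statement about the cohomology of graphs with coefficients in
`ZMod 2`.  A finite graph is a forest if and only if its `H¹` vanishes: every labelling of the edges
is the coboundary of a potential on the vertices
(`SimpleGraph.isAcyclic_iff_forall_exists_potential`).  A test of the composition is the union of
a test of `M` and a test of `M'` along the interface `X`.  Both of these being forests, a
labelling of the union has potentials on both sides, which can be changed by functions that are
constant on the connected components; they can be made to agree on `X` exactly when their difference
there is a function of the block in `p` plus a function of the block in `q`.  Every function on `X`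
occurs as such a difference, and that all of them decompose in this way says that the incidence
graph of `p|X` and `q|X` is a forest (`weakOrth_iff_forall_exists_add`,
`Interface.test_comp_acyclic_iff`).  This is a Mayer-Vietoris argument; its analogue in degree
zero, about unions of connected components that avoid the border, gives the second half of the
criterion (`Interface.test_comp_connected_iff`).

The program loops over the pairs of partitions and contracts the edges of the incidence graph one
by one: the edge must have distinct ends when its turn comes, and one end is then renamed to the
other (`isForestFrom_iff_relabel`, `isAnchoredFrom_iff_relabel`).  When all edges are contracted,
equal numbers mean connected blocks.  The border of the structures may be much larger than the
running time allows to inspect, so whether a block leaves the interface is found by comparing its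
tabulated size with the number of its elements in the interface
(`Tabulation.blockSize_sub_sum_ne_zero_iff`).

The program is written in a small language of bounded loops and bounded sums, with a semantics by
recursion (`Prog.run`) and a compiler to the machine (`Prog.compile`).  The number of rounds of
every loop is an entry of the input, so the running time is bounded by a polynomial in the largest
of these entries, which is computed from the program (`Prog.cost`, `Prog.haltsWithin_compile`).
-/

/-! ### Acyclicity and connectedness through functions on the vertices -/

/-- A function that is constant along edges is constant on connected components. -/
theorem SimpleGraph.Reachable.apply_eq {W α : Type*} {H : SimpleGraph W} {φ : W → α}
    (hφ : ∀ x y, H.Adj x y → φ x = φ y) {u v : W} (h : H.Reachable u v) : φ u = φ v := by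
  obtain ⟨p⟩ := h
  induction p with
  | nil => rfl
  | cons h _ ih => exact (hφ _ _ h).trans ih

/-- A finite graph is a forest if and only if its first cohomology with coefficients in `ZMod 2`
vanishes: every labelling of the edges is the coboundary of a potential on the vertices. -/
theorem SimpleGraph.isAcyclic_iff_forall_exists_potential {W : Type*} [Finite W]
    (H : SimpleGraph W) :
    H.IsAcyclic ↔ ∀ w : Sym2 W → ZMod 2, ∃ φ : W → ZMod 2, ∀ x y, H.Adj x y →
      φ x + φ y = w s(x, y) := by
  classical
  constructor
  · intro hH w
    induction hn : H.edgeSet.ncard generalizing H with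
    | zero =>
      rw [Set.ncard_eq_zero (Set.toFinite _), SimpleGraph.edgeSet_eq_empty] at hn
      subst hn
      exact ⟨0, by simp⟩
    | succ n ih =>
      have hne : H.edgeSet.Nonempty := by
        rw [← Set.ncard_pos (Set.toFinite _)]; omega
      obtain ⟨e, he⟩ := hne
      induction e with | _ a b
      have hb := SimpleGraph.isAcyclic_iff_forall_isBridge.1 hH he
      rw [SimpleGraph.isBridge_iff] at hb
      obtain ⟨φ, hφ⟩ := ih (H.deleteEdges {s(a, b)}) (hH.anti (H.deleteEdges_le _)) (by
        rw [SimpleGraph.edgeSet_deleteEdges, Set.ncard_sdiff_singleton_of_mem he, hn]; rfl)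
      -- The removal of the bridge separates `a` from `b`, so the potential may be shifted on the
      -- side of `a` to give the bridge its prescribed label.
      let c := w s(a, b) - (φ a + φ b)
      refine ⟨fun v => φ v + if (H.deleteEdges {s(a, b)}).Reachable a v then c else 0, ?_⟩
      have key : ∀ x y, s(x, y) ≠ s(a, b) → H.Adj x y →
          (H.deleteEdges {s(a, b)}).Adj x y := fun x y h h' => by
        simpa [SimpleGraph.deleteEdges_adj] using ⟨h', by simpa using h⟩
      intro x y hxy
      by_cases hs : s(x, y) = s(a, b)
      · have hab : (H.deleteEdges {s(a, b)}).Reachable a a := SimpleGraph.Reachable.refl _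
        rw [hs]
        rcases Sym2.eq_iff.1 hs with ⟨rfl, rfl⟩ | ⟨rfl, rfl⟩
        · simp only [if_pos hab, if_neg hb, c]; ring
        · simp only [if_pos hab, if_neg hb, c]; ring
      · have hadj := key x y hs hxy
        have : (H.deleteEdges {s(a, b)}).Reachable a x ↔
            (H.deleteEdges {s(a, b)}).Reachable a y :=
          ⟨fun h => h.trans hadj.reachable, fun h => h.trans hadj.symm.reachable⟩
        rw [← hφ x y hadj]
        simp only [this]
        have h2 : ∀ d : ZMod 2, d + d = 0 := CharTwo.add_self_eq_zero
        linear_combination h2 (if (H.deleteEdges {s(a, b)}).Reachable a y then c else 0)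
  · intro h
    rw [SimpleGraph.isAcyclic_iff_forall_isBridge]
    intro e he
    induction e with | _ a b
    rw [SimpleGraph.isBridge_iff]
    intro hr
    -- A potential for the indicator function of the edge is constant off that edge.
    obtain ⟨φ, hφ⟩ := h fun e => if e = s(a, b) then 1 else 0
    have h1 := hφ a b he
    have h2 := hr.apply_eq (φ := φ) (fun x y hxy => by
      rw [SimpleGraph.deleteEdges_adj] at hxy
      have := hφ x y hxy.1
      rw [if_neg (by simpa using hxy.2)] at this
      exact CharTwo.add_eq_zero.1 this)
    rw [h2, CharTwo.add_self_eq_zero, if_pos rfl] at h1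
    exact zero_ne_one h1

/-- A function given on some vertices, equal on connected ones, extends to a function that is
constant along edges and has a default value off their components. -/
theorem SimpleGraph.exists_extension {W ι α : Type*} (H : SimpleGraph W) (g : ι → W) (a : ι → α)
    (d : α) (ha : ∀ i j, H.Reachable (g i) (g j) → a i = a j) :
    ∃ φ : W → α, (∀ x y, H.Adj x y → φ x = φ y) ∧ (∀ i, φ (g i) = a i) ∧
      ∀ x, φ x = d ∨ ∃ i, H.Reachable (g i) x := by
  classical
  have key : ∀ x i, H.Reachable (g i) x →
      (if h : ∃ i, H.Reachable (g i) x then a h.choose else d) = a i := fun x i hi => by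
    have h : ∃ i, H.Reachable (g i) x := ⟨i, hi⟩
    rw [dif_pos h]
    exact ha _ _ (h.choose_spec.trans hi.symm)
  refine ⟨fun x => if h : ∃ i, H.Reachable (g i) x then a h.choose else d, ?_, ?_, ?_⟩
  · intro x y hxy
    by_cases h : ∃ i, H.Reachable (g i) x
    · obtain ⟨i, hi⟩ := h
      exact (key x i hi).trans (key y i (hi.trans hxy.reachable)).symm
    · have h' : ¬ ∃ i, H.Reachable (g i) y := fun ⟨i, hi⟩ => h ⟨i, hi.trans hxy.symm.reachable⟩
      simp only [dif_neg h, dif_neg h']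
  · exact fun i => key _ i (SimpleGraph.Reachable.refl _)
  · intro x
    by_cases h : ∃ i, H.Reachable (g i) x
    · exact Or.inr h
    · exact Or.inl (dif_neg h)

namespace UHypergraph

variable {V E : Type*} (G : UHypergraph V E)

theorem incidence_adj_inl_inr {v : V} {e : E} :
    G.incidence.Adj (Sum.inl v) (Sum.inr e) ↔ v ∈ G.inc e := by
  simp [incidence, SimpleGraph.fromRel_adj]

theorem forall_incidence_adj {P : V ⊕ E → V ⊕ E → Prop} (hP : ∀ x y, P x y → P y x) :
    (∀ x y, G.incidence.Adj x y → P x y) ↔ ∀ e, ∀ v ∈ G.inc e, P (Sum.inl v) (Sum.inr e) := by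
  constructor
  · exact fun h e v hv => h _ _ (G.incidence_adj_inl_inr.2 hv)
  · intro h x y hxy
    simp only [incidence, SimpleGraph.fromRel_adj] at hxy
    rcases hxy.2 with ⟨v, e, hv, rfl, rfl⟩ | ⟨v, e, hv, rfl, rfl⟩
    · exact h e v hv
    · exact hP _ _ (h e v hv)

theorem acyclic_iff_forall_exists_potential [Finite V] [Finite E] :
    G.Acyclic ↔ ∀ w : V → E → ZMod 2, ∃ (φ : V → ZMod 2) (ψ : E → ZMod 2),
      ∀ e, ∀ v ∈ G.inc e, φ v + ψ e = w v e := by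
  rw [Acyclic, SimpleGraph.isAcyclic_iff_forall_exists_potential]
  constructor
  · intro h w
    let w' : V ⊕ E → V ⊕ E → ZMod 2 := fun x y => match x, y with
      | .inl v, .inr e => w v e
      | .inr e, .inl v => w v e
      | _, _ => 0
    have hw' : ∀ x y, w' x y = w' y x := by rintro (v | e) (v' | e') <;> rfl
    obtain ⟨φ, hφ⟩ := h (Sym2.lift ⟨w', hw'⟩)
    exact ⟨fun v => φ (Sum.inl v), fun e => φ (Sum.inr e),
      fun e v hv => hφ _ _ (G.incidence_adj_inl_inr.2 hv)⟩
  · intro h w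
    obtain ⟨φ, ψ, hφ⟩ := h fun v e => w s(Sum.inl v, Sum.inr e)
    refine ⟨Sum.elim φ ψ, (G.forall_incidence_adj fun x y h => ?_).2 hφ⟩
    rw [add_comm, h, Sym2.eq_swap]

variable {G}

theorem Connected.symm {u v : V} (h : G.Connected u v) : G.Connected v u :=
  SimpleGraph.Reachable.symm h

theorem Connected.trans {u v w : V} (h : G.Connected u v) (h' : G.Connected v w) :
    G.Connected u w :=
  SimpleGraph.Reachable.trans h h'

theorem connected_of_mem_inc {u v : V} {e : E} (hu : u ∈ G.inc e) (hv : v ∈ G.inc e) :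
    G.Connected u v :=
  (G.incidence_adj_inl_inr.2 hu).reachable.trans (G.incidence_adj_inl_inr.2 hv).symm.reachable

/-- A function on the vertices that is constant on every hyperedge is constant on connected
components. -/
theorem Connected.apply_eq {α : Type*} [Nonempty α] {u v : V} (h : G.Connected u v) {φ : V → α}
    (hφ : ∀ e, ∀ x ∈ G.inc e, ∀ y ∈ G.inc e, φ x = φ y) : φ u = φ v := by
  classical
  let ψ : E → α := fun e => if h : (G.inc e).Nonempty then φ h.choose else Classical.arbitrary α
  refine SimpleGraph.Reachable.apply_eq (φ := Sum.elim φ ψ)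
    ((G.forall_incidence_adj fun _ _ => Eq.symm).2 fun e v hv => ?_) h
  have hne : (G.inc e).Nonempty := ⟨v, hv⟩
  simp only [Sum.elim_inl, Sum.elim_inr, ψ, dif_pos hne]
  exact hφ e _ hv _ hne.choose_spec

variable (G)

/-- Every vertex is connected to a vertex in `S` if and only if no nonempty union of connected
components avoids `S`. -/
theorem forall_exists_connected_iff {S : Set V} :
    (∀ v, ∃ b ∈ S, G.Connected v b) ↔
      ∀ f : V → Prop, (∀ e, ∀ x ∈ G.inc e, ∀ y ∈ G.inc e, f x = f y) → (∀ b ∈ S, ¬ f b) →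
        ∀ v, ¬ f v := by
  constructor
  · intro h f hf hS v hv
    obtain ⟨b, hb, hvb⟩ := h v
    exact hS b hb (hvb.apply_eq hf ▸ hv)
  · intro h v
    by_contra! hc
    exact h (fun x => G.Connected v x)
      (fun e x hx y hy => propext
        ⟨fun k => k.trans (connected_of_mem_inc hx hy),
          fun k => k.trans (connected_of_mem_inc hy hx)⟩)
      hc v (SimpleGraph.Reachable.refl _)

end UHypergraph

section Partitions

variable {α : Type*} (p q : Setoid α)

/-- Two partitions are weakly orthogonal if and only if every function with values in `ZMod 2` is
the sum of a function of the block in `p` and a function of the block in `q`. -/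
theorem weakOrth_iff_forall_exists_add [Finite α] :
    WeakOrth p q ↔ ∀ f : α → ZMod 2, ∃ a b : α → ZMod 2, (∀ i j, p i j → a i = a j) ∧
      (∀ i j, q i j → b i = b j) ∧ ∀ i, a i + b i = f i := by
  rw [WeakOrth, UHypergraph.acyclic_iff_forall_exists_potential]
  constructor
  · intro h f
    obtain ⟨φ, ψ, hφ⟩ := h fun v i => match v with | .inl _ => f i | .inr _ => 0
    refine ⟨fun i => φ (Sum.inl (Quotient.mk p i)), fun i => φ (Sum.inr (Quotient.mk q i)),
      fun i j hij => congrArg (fun v => φ (Sum.inl v)) (Quotient.sound (s := p) hij),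
      fun i j hij => congrArg (fun v => φ (Sum.inr v)) (Quotient.sound (s := q) hij),
      fun i => ?_⟩
    have h1 := hφ i (Sum.inl (Quotient.mk p i)) (Or.inl rfl)
    have h2 := hφ i (Sum.inr (Quotient.mk q i)) (Or.inr rfl)
    linear_combination h1 + h2 - CharTwo.add_self_eq_zero (ψ i)
  · intro h w
    obtain ⟨a, b, ha, hb, hab⟩ := h fun i =>
      w (Sum.inl (Quotient.mk p i)) i + w (Sum.inr (Quotient.mk q i)) i
    refine ⟨Sum.elim (Quotient.lift a ha) (Quotient.lift b hb),
      fun i => a i + w (Sum.inl (Quotient.mk p i)) i, ?_⟩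
    rintro i v (rfl | rfl)
    · change a i + (a i + _) = _
      linear_combination CharTwo.add_self_eq_zero (a i)
    · change b i + (a i + _) = _
      linear_combination hab i + CharTwo.add_self_eq_zero (w (Sum.inl (Quotient.mk p i)) i)

/-- Every edge of the graph of incidence is connected to an edge in `S` if and only if no nonempty
set of edges is a union of blocks of `p` and a union of blocks of `q` and avoids `S`. -/
theorem forall_exists_connected_incidenceGraph_iff {S : Set α} :
    (∀ i, ∃ j ∈ S, (incidenceGraph p q).Connected
      (Sum.inl (Quotient.mk _ i)) (Sum.inl (Quotient.mk _ j))) ↔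
      ∀ f : α → Prop, (∀ i j, p i j → f i = f j) → (∀ i j, q i j → f i = f j) →
        (∀ j ∈ S, ¬ f j) → ∀ i, ¬ f i := by
  constructor
  · intro h f hp hq hS i hi
    obtain ⟨j, hj, hij⟩ := h i
    have := hij.apply_eq (φ := Sum.elim (Quotient.lift f hp) (Quotient.lift f hq)) (by
      rintro e _ (rfl | rfl) _ (rfl | rfl) <;> rfl)
    exact hS j hj (Eq.mp this hi)
  · intro h i
    by_contra! hc
    have hlr : ∀ j, (incidenceGraph p q).Connected (Sum.inl (Quotient.mk _ j))
        (Sum.inr (Quotient.mk _ j)) := fun j =>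
      UHypergraph.connected_of_mem_inc (e := j) (Or.inl rfl) (Or.inr rfl)
    refine h (fun j => (incidenceGraph p q).Connected (Sum.inl (Quotient.mk _ i))
      (Sum.inl (Quotient.mk _ j))) (fun j j' hj => by rw [Quotient.sound (s := p) hj])
      (fun j j' hj => ?_) hc i (SimpleGraph.Reachable.refl _)
    have hjj' : (incidenceGraph p q).Connected (Sum.inl (Quotient.mk _ j))
        (Sum.inl (Quotient.mk _ j')) := by
      have := hlr j
      rw [Quotient.sound (s := q) hj] at this
      exact this.trans (hlr j').symm
    exact propext ⟨fun k => k.trans hjj', fun k => k.trans hjj'.symm⟩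

end Partitions

/-! ### The composition of two structures -/

namespace Interface

variable {V L V' L' : Type*} {M : MStr V L} {M' : MStr V' L'} (X : Interface M M')

theorem right_h (j : Fin X.k) : X.right (X.h j) = Sum.inl (X.g j) := by
  have hw : X.h j ∈ Set.range X.h := ⟨j, rfl⟩
  rw [right, dif_pos hw, X.h.injective hw.choose_spec]

theorem right_of_notMem {w : V'} (hw : w ∉ Set.range X.h) : X.right w = Sum.inr ⟨w, hw⟩ :=
  dif_neg hw

theorem right_eq_inl_iff {w : V'} {v : V} :
    X.right w = Sum.inl v ↔ ∃ j, X.h j = w ∧ X.g j = v := by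
  constructor
  · intro h
    by_cases hw : w ∈ Set.range X.h
    · obtain ⟨j, rfl⟩ := hw
      exact ⟨j, rfl, Sum.inl_injective ((X.right_h j).symm.trans h)⟩
    · simp [X.right_of_notMem hw] at h
  · rintro ⟨j, rfl, rfl⟩
    exact X.right_h j

theorem right_injective : Function.Injective X.right := by
  intro w w' h
  by_cases hw' : w' ∈ Set.range X.h
  · obtain ⟨j', rfl⟩ := hw'
    rw [X.right_h, X.right_eq_inl_iff] at h
    obtain ⟨j, rfl, hj⟩ := h
    rw [X.g.injective hj]
  · by_cases hw : w ∈ Set.range X.h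
    · obtain ⟨j, rfl⟩ := hw
      simp [X.right_h, X.right_of_notMem hw'] at h
    · simpa [X.right_of_notMem hw', X.right_of_notMem hw] using h

theorem vertex_cases {P : X.Vertex → Prop} (hl : ∀ v, P (Sum.inl v)) (hr : ∀ w, P (X.right w))
    (z : X.Vertex) : P z := by
  rcases z with v | ⟨w, hw⟩
  · exact hl v
  · rw [← X.right_of_notMem hw]; exact hr w

/-- Functions on the vertices of the two structures that agree on the interface glue to a function
on the vertices of the composition. -/
theorem exists_glue {α : Type*} (f : V → α) (f' : V' → α) (h : ∀ j, f (X.g j) = f' (X.h j)) :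
    ∃ F : X.Vertex → α, (∀ v, F (Sum.inl v) = f v) ∧ ∀ w, F (X.right w) = f' w := by
  refine ⟨Sum.elim f fun w => f' w, fun v => rfl, fun w => ?_⟩
  by_cases hw : w ∈ Set.range X.h
  · obtain ⟨j, rfl⟩ := hw
    rw [X.right_h]; exact h j
  · rw [X.right_of_notMem hw]; rfl

theorem comp_isLinear (hM : M.IsLinear) (hM' : M'.IsLinear) : X.comp.IsLinear where
  src_inj := by
    rintro (l | l) i (l' | l') i' h
    · cases hM.src_inj l i l' i' (Sum.inl_injective h); rfl
    · obtain ⟨j, hj, -⟩ := X.right_eq_inl_iff.1 (Eq.symm h)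
      exact absurd hj.symm (X.h_mem j l' i')
    · obtain ⟨j, hj, -⟩ := X.right_eq_inl_iff.1 h
      exact absurd hj.symm (X.h_mem j l i)
    · cases hM'.src_inj l i l' i' (X.right_injective h); rfl
  tgt_inj := by
    rintro (l | l) i (l' | l') i' h
    · cases hM.tgt_inj l i l' i' (Sum.inl_injective h); rfl
    · obtain ⟨j, -, hj⟩ := X.right_eq_inl_iff.1 (Eq.symm h)
      exact absurd hj.symm (X.g_mem j l i)
    · obtain ⟨j, -, hj⟩ := X.right_eq_inl_iff.1 h
      exact absurd hj.symm (X.g_mem j l' i')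
    · cases hM'.tgt_inj l i l' i' (X.right_injective h); rfl
  src_ne_tgt := by
    rintro (l | l) i j h
    · exact hM.src_ne_tgt l i j (Sum.inl_injective h)
    · exact hM'.src_ne_tgt l i j (X.right_injective h)

/-- A switching of the composition is a pair of switchings. -/
def switchingEquiv : X.comp.Switching ≃ M.Switching × M'.Switching where
  toFun σ := ⟨fun l => σ (Sum.inl l), fun l => σ (Sum.inr l)⟩
  invFun σ := fun l => match l with
    | .inl l => σ.1 l
    | .inr l => σ.2 l
  left_inv σ := by funext l; cases l <;> rfl
  right_inv _ := rfl

/-- The hyperedges of a test of `M` as hyperedges of a test of the composition. -/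
def edgeLeft (σ : X.comp.Switching) (e : Σ l, Quotient ((X.switchingEquiv σ).1 l).1) :
    Σ l, Quotient (σ l).1 := ⟨Sum.inl e.1, e.2⟩

/-- The hyperedges of a test of `M'` as hyperedges of a test of the composition. -/
def edgeRight (σ : X.comp.Switching) (e : Σ l, Quotient ((X.switchingEquiv σ).2 l).1) :
    Σ l, Quotient (σ l).1 := ⟨Sum.inr e.1, e.2⟩

theorem inc_edgeLeft (σ : X.comp.Switching) (e) :
    (X.comp.test σ).inc (X.edgeLeft σ e) =
      Sum.inl '' (M.test (X.switchingEquiv σ).1).inc e := by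
  have key : ∀ x, X.comp.at' (Sum.inl e.1) x = Sum.inl (M.at' e.1 x) := by
    rintro (x | x) <;> rfl
  ext v
  constructor
  · rintro ⟨x, hx, rfl⟩
    exact ⟨M.at' e.1 x, ⟨x, hx, rfl⟩, (key x).symm⟩
  · rintro ⟨_, ⟨x, hx, rfl⟩, rfl⟩
    exact ⟨x, hx, key x⟩

theorem inc_edgeRight (σ : X.comp.Switching) (e) :
    (X.comp.test σ).inc (X.edgeRight σ e) =
      X.right '' (M'.test (X.switchingEquiv σ).2).inc e := by
  have key : ∀ x, X.comp.at' (Sum.inr e.1) x = X.right (M'.at' e.1 x) := by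
    rintro (x | x) <;> rfl
  ext v
  constructor
  · rintro ⟨x, hx, rfl⟩
    exact ⟨M'.at' e.1 x, ⟨x, hx, rfl⟩, (key x).symm⟩
  · rintro ⟨_, ⟨x, hx, rfl⟩, rfl⟩
    exact ⟨x, hx, key x⟩

theorem edge_cases (σ : X.comp.Switching) {P : (Σ l, Quotient (σ l).1) → Prop}
    (hl : ∀ e, P (X.edgeLeft σ e)) (hr : ∀ e, P (X.edgeRight σ e)) (e) : P e := by
  obtain ⟨l | l, b⟩ := e
  · exact hl ⟨l, b⟩
  · exact hr ⟨l, b⟩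

/-- Functions on the hyperedges of the tests of the two structures glue to a function on the
hyperedges of the test of the composition. -/
theorem exists_glue_edge (σ : X.comp.Switching) {α : Type*}
    (f : (Σ l, Quotient ((X.switchingEquiv σ).1 l).1) → α)
    (f' : (Σ l, Quotient ((X.switchingEquiv σ).2 l).1) → α) :
    ∃ F : (Σ l, Quotient (σ l).1) → α,
      (∀ e, F (X.edgeLeft σ e) = f e) ∧ ∀ e, F (X.edgeRight σ e) = f' e :=
  ⟨fun e => match e with
    | ⟨.inl l, b⟩ => f ⟨l, b⟩
    | ⟨.inr l, b⟩ => f' ⟨l, b⟩, fun _ => rfl, fun _ => rfl⟩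

theorem left_mem_border {v : V} (hv : v ∉ Set.range X.g) :
    Sum.inl v ∈ X.comp.border ↔ v ∈ M.border := by
  have key : ∀ w, X.right w ≠ Sum.inl v := fun w hw => by
    obtain ⟨j, -, hj⟩ := X.right_eq_inl_iff.1 hw
    exact hv ⟨j, hj⟩
  refine or_congr ⟨fun h l j k => h (Sum.inl l) j (congrArg Sum.inl k), ?_⟩
    ⟨fun h l j k => h (Sum.inl l) j (congrArg Sum.inl k), ?_⟩
  · rintro h (l | l) j k
    exacts [h l j (Sum.inl_injective k), key _ k]
  · rintro h (l | l) j k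
    exacts [h l j (Sum.inl_injective k), key _ k]

theorem right_mem_border {w : V'} (hw : w ∉ Set.range X.h) :
    X.right w ∈ X.comp.border ↔ w ∈ M'.border := by
  have key : ∀ v, Sum.inl v ≠ X.right w := fun v hv => by
    obtain ⟨j, hj, -⟩ := X.right_eq_inl_iff.1 hv.symm
    exact hw ⟨j, hj⟩
  refine or_congr ⟨fun h l j k => h (Sum.inr l) j (congrArg X.right k), ?_⟩
    ⟨fun h l j k => h (Sum.inr l) j (congrArg X.right k), ?_⟩
  · rintro h (l | l) j k
    exacts [key _ k, h l j (X.right_injective k)]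
  · rintro h (l | l) j k
    exacts [key _ k, h l j (X.right_injective k)]

theorem g_mem_border (j : Fin X.k) :
    Sum.inl (X.g j) ∈ X.comp.border ↔ X.g j ∈ M.outputs ∨ X.h j ∈ M'.inputs := by
  rw [or_comm]
  refine or_congr ⟨fun h l i k => h (Sum.inr l) i ?_, ?_⟩
    ⟨fun h l i k => h (Sum.inl l) i (congrArg Sum.inl k), ?_⟩
  · rw [← X.right_h, ← k]; rfl
  · rintro h (l | l) i k
    · exact X.g_mem j l i (Sum.inl_injective k)
    · exact h l i (X.right_injective (k.trans (X.right_h j).symm))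
  · rintro h (l | l) i k
    · exact h l i (Sum.inl_injective k)
    · exact X.h_mem j l i (X.right_injective (k.trans (X.right_h j).symm))

theorem restrictLeft_testPartition {σ : M.Switching} {i j : Fin X.k} :
    X.restrictLeft (M.testPartition σ) i j ↔ (M.test σ).Connected (X.g i) (X.g j) :=
  Iff.rfl

theorem restrictRight_testPartition {σ : M'.Switching} {i j : Fin X.k} :
    X.restrictRight (M'.testPartition σ) i j ↔ (M'.test σ).Connected (X.h i) (X.h j) :=
  Iff.rfl

/-- Potentials on the two tests can be glued, after a function constant on connected components is
added to each, exactly when their difference on the interface is the sum of a function of the block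
of `M` and a function of the block of `M'`. -/
theorem test_comp_acyclic_iff [Finite V] [Finite L] [Finite V'] [Finite L']
    (hM : M.IsComponent) (hM' : M'.IsComponent) (σ : X.comp.Switching) :
    (X.comp.test σ).Acyclic ↔
      WeakOrth (X.restrictLeft (M.testPartition (X.switchingEquiv σ).1))
        (X.restrictRight (M'.testPartition (X.switchingEquiv σ).2)) := by
  have hA := hM.acyclic (X.switchingEquiv σ).1
  have hB := hM'.acyclic (X.switchingEquiv σ).2
  rw [UHypergraph.acyclic_iff_forall_exists_potential] at hA hB ⊢
  rw [weakOrth_iff_forall_exists_add]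
  constructor
  · intro h f
    obtain ⟨ω, hω, hω'⟩ := X.exists_glue_edge σ (fun _ => (1 : ZMod 2)) (fun _ => 0)
    obtain ⟨F, hF, -⟩ := X.exists_glue (Function.extend X.g f 0) (Function.extend X.h f 0)
      fun j => by rw [X.g.injective.extend_apply, X.h.injective.extend_apply]
    have hFg : ∀ j, F (Sum.inl (X.g j)) = f j := fun j => by
      rw [hF, X.g.injective.extend_apply]
    -- The labelling is `f` on the side of `M` and `0` on the side of `M'`.
    obtain ⟨φ, ψ, hφ⟩ := h fun v e => ω e * F v
    refine ⟨fun j => φ (Sum.inl (X.g j)) + F (Sum.inl (X.g j)), fun j => φ (X.right (X.h j)),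
      fun i j hij => ?_, fun i j hij => ?_, fun j => ?_⟩
    · refine (X.restrictLeft_testPartition.1 hij).apply_eq
        (φ := fun v => φ (Sum.inl v) + F (Sum.inl v)) fun e => ?_
      have key : ∀ x ∈ (M.test (X.switchingEquiv σ).1).inc e,
          φ (Sum.inl x) + F (Sum.inl x) = ψ (X.edgeLeft σ e) := fun x hx => by
        have := hφ (X.edgeLeft σ e) (Sum.inl x)
          (by rw [X.inc_edgeLeft]; exact Set.mem_image_of_mem _ hx)
        rw [hω] at this
        linear_combination this + CharTwo.add_self_eq_zero (F (Sum.inl x)) -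
          CharTwo.add_self_eq_zero (ψ (X.edgeLeft σ e))
      exact fun x hx y hy => (key x hx).trans (key y hy).symm
    · refine (X.restrictRight_testPartition.1 hij).apply_eq
        (φ := fun v => φ (X.right v)) fun e => ?_
      have key : ∀ x ∈ (M'.test (X.switchingEquiv σ).2).inc e,
          φ (X.right x) = ψ (X.edgeRight σ e) := fun x hx => by
        have := hφ (X.edgeRight σ e) (X.right x)
          (by rw [X.inc_edgeRight]; exact Set.mem_image_of_mem _ hx)
        rw [hω'] at this
        linear_combination this - CharTwo.add_self_eq_zero (ψ (X.edgeRight σ e))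
      exact fun x hx y hy => (key x hx).trans (key y hy).symm
    · change φ (Sum.inl (X.g j)) + F (Sum.inl (X.g j)) + φ (X.right (X.h j)) = f j
      rw [X.right_h, ← hFg]
      linear_combination CharTwo.add_self_eq_zero (φ (Sum.inl (X.g j)))
  · intro h w
    obtain ⟨φ, ψ, hφ⟩ := hA fun v e => w (Sum.inl v) (X.edgeLeft σ e)
    obtain ⟨φ', ψ', hφ'⟩ := hB fun v e => w (X.right v) (X.edgeRight σ e)
    obtain ⟨a, b, ha, hb, hab⟩ := h fun j => φ (X.g j) + φ' (X.h j)
    obtain ⟨A, hA, hAg, -⟩ := (M.test (X.switchingEquiv σ).1).incidence.exists_extension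
      (fun j => Sum.inl (X.g j)) a 0 ha
    obtain ⟨B, hB, hBh, -⟩ := (M'.test (X.switchingEquiv σ).2).incidence.exists_extension
      (fun j => Sum.inl (X.h j)) b 0 hb
    obtain ⟨Φ, hΦ, hΦ'⟩ := X.exists_glue (fun v => φ v + A (Sum.inl v))
      (fun v => φ' v + B (Sum.inl v)) fun j => by
        rw [hAg, hBh]
        linear_combination hab j - CharTwo.add_self_eq_zero (b j) +
          CharTwo.add_self_eq_zero (φ (X.g j))
    obtain ⟨Ψ, hΨ, hΨ'⟩ := X.exists_glue_edge σ (fun e => ψ e + A (Sum.inr e))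
      (fun e => ψ' e + B (Sum.inr e))
    refine ⟨Φ, Ψ, X.edge_cases σ (fun e => ?_) (fun e => ?_)⟩
    · rw [X.inc_edgeLeft]
      rintro _ ⟨v, hv, rfl⟩
      have := hA _ _ ((UHypergraph.incidence_adj_inl_inr _).2 hv)
      rw [hΦ, hΨ, ← hφ e v hv, this]
      linear_combination CharTwo.add_self_eq_zero (A (Sum.inr e))
    · rw [X.inc_edgeRight]
      rintro _ ⟨v, hv, rfl⟩
      have := hB _ _ ((UHypergraph.incidence_adj_inl_inr _).2 hv)
      rw [hΦ', hΨ', ← hφ' e v hv, this]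
      linear_combination CharTwo.add_self_eq_zero (B (Sum.inr e))

theorem anchored_iff (p : Setoid M.border) (q : Setoid M'.border) :
    X.Anchored p q ↔ ∀ f : Fin X.k → Prop, (∀ i j, X.restrictLeft p i j → f i = f j) →
      (∀ i j, X.restrictRight q i j → f i = f j) → (∀ j, X.Escapes p q j → ¬ f j) →
      ∀ i, ¬ f i :=
  forall_exists_connected_incidenceGraph_iff _ _ (S := {j | X.Escapes p q j})

/-- A union of components of a test of the composition that avoids the border meets the interface
in a set that avoids the escaping elements, and every such set extends to a union of components. -/
theorem test_comp_connected_iff (hM : M.IsComponent) (hM' : M'.IsComponent)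
    (σ : X.comp.Switching) :
    (∀ v, ∃ b ∈ X.comp.border, (X.comp.test σ).Connected v b) ↔
      X.Anchored (M.testPartition (X.switchingEquiv σ).1)
        (M'.testPartition (X.switchingEquiv σ).2) := by
  rw [anchored_iff, UHypergraph.forall_exists_connected_iff]
  constructor
  · intro h f hp hq hf i hi
    obtain ⟨A, hA, hAg, hAd⟩ := (M.test (X.switchingEquiv σ).1).incidence.exists_extension
      (fun j => Sum.inl (X.g j)) f False hp
    obtain ⟨B, hB, hBh, hBd⟩ := (M'.test (X.switchingEquiv σ).2).incidence.exists_extension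
      (fun j => Sum.inl (X.h j)) f False hq
    obtain ⟨F, hF, hF'⟩ := X.exists_glue (fun v => A (Sum.inl v)) (fun v => B (Sum.inl v))
      fun j => by rw [hAg, hBh]
    refine h F (X.edge_cases σ (fun e => ?_) (fun e => ?_)) (X.vertex_cases ?_ ?_)
      (Sum.inl (X.g i)) ?_
    · rw [X.inc_edgeLeft]
      rintro _ ⟨v, hv, rfl⟩ _ ⟨v', hv', rfl⟩
      rw [hF, hF, hA _ _ ((UHypergraph.incidence_adj_inl_inr _).2 hv),
        hA _ _ ((UHypergraph.incidence_adj_inl_inr _).2 hv')]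
    · rw [X.inc_edgeRight]
      rintro _ ⟨v, hv, rfl⟩ _ ⟨v', hv', rfl⟩
      rw [hF', hF', hB _ _ ((UHypergraph.incidence_adj_inl_inr _).2 hv),
        hB _ _ ((UHypergraph.incidence_adj_inl_inr _).2 hv')]
    · intro v hv
      rw [hF]
      by_cases hvg : v ∈ Set.range X.g
      · obtain ⟨j, rfl⟩ := hvg
        rw [hAg]
        exact hf j (((X.g_mem_border j).1 hv).imp_right Or.inl)
      · rw [X.left_mem_border hvg] at hv
        rcases hAd (Sum.inl v) with h0 | ⟨j, hj⟩
        · rw [h0]; exact id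
        · rw [← hj.apply_eq hA, hAg]
          exact hf j (Or.inr (Or.inr (Or.inl ⟨⟨v, hv⟩, hvg, hj⟩)))
    · intro v hv
      rw [hF']
      by_cases hvh : v ∈ Set.range X.h
      · obtain ⟨j, rfl⟩ := hvh
        rw [X.right_h] at hv
        rw [hBh]
        exact hf j (((X.g_mem_border j).1 hv).imp_right Or.inl)
      · rw [X.right_mem_border hvh] at hv
        rcases hBd (Sum.inl v) with h0 | ⟨j, hj⟩
        · rw [h0]; exact id
        · rw [← hj.apply_eq hB, hBh]
          exact hf j (Or.inr (Or.inr (Or.inr ⟨⟨v, hv⟩, hvh, hj⟩)))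
    · rw [hF, hAg]; exact hi
  · intro h f hf hb
    have hA : ∀ {u v}, (M.test (X.switchingEquiv σ).1).Connected u v →
        f (Sum.inl u) = f (Sum.inl v) := fun huv =>
      huv.apply_eq (φ := fun v => f (Sum.inl v)) fun e x hx y hy =>
        hf (X.edgeLeft σ e) _ (by rw [X.inc_edgeLeft]; exact Set.mem_image_of_mem _ hx) _
          (by rw [X.inc_edgeLeft]; exact Set.mem_image_of_mem _ hy)
    have hB : ∀ {u v}, (M'.test (X.switchingEquiv σ).2).Connected u v →
        f (X.right u) = f (X.right v) := fun huv =>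
      huv.apply_eq (φ := fun v => f (X.right v)) fun e x hx y hy =>
        hf (X.edgeRight σ e) _ (by rw [X.inc_edgeRight]; exact Set.mem_image_of_mem _ hx) _
          (by rw [X.inc_edgeRight]; exact Set.mem_image_of_mem _ hy)
    have key : ∀ j, ¬ f (Sum.inl (X.g j)) := by
      refine h (fun j => f (Sum.inl (X.g j))) (fun i j hij => hA hij) (fun i j hij => ?_) ?_
      · rw [← X.right_h, ← X.right_h]
        exact hB hij
      · rintro j (hj | hj | ⟨y, hy, hj⟩ | ⟨z, hz, hj⟩)
        · exact hb _ ((X.g_mem_border j).2 (Or.inl hj))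
        · exact hb _ ((X.g_mem_border j).2 (Or.inr hj))
        · exact fun k => hb _ ((X.left_mem_border hy).2 y.2) (Eq.mp (hA hj) k)
        · rw [← X.right_h]
          exact fun k => hb _ ((X.right_mem_border hz).2 z.2) (Eq.mp (hB hj) k)
    refine X.vertex_cases (fun v => ?_) (fun v => ?_)
    · obtain ⟨y, hy, hvy⟩ := hM.connected (X.switchingEquiv σ).1 v
      rw [hA hvy]
      by_cases hyg : y ∈ Set.range X.g
      · obtain ⟨j, rfl⟩ := hyg
        exact key j
      · exact hb _ ((X.left_mem_border hyg).2 hy)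
    · obtain ⟨y, hy, hvy⟩ := hM'.connected (X.switchingEquiv σ).2 v
      rw [hB hvy]
      by_cases hyh : y ∈ Set.range X.h
      · obtain ⟨j, rfl⟩ := hyh
        rw [X.right_h]
        exact key j
      · exact hb _ ((X.right_mem_border hyh).2 hy)

theorem expands_iff [Finite V] [Finite L] [Finite V'] [Finite L']
    (hM : M.IsComponent) (hM' : M'.IsComponent) :
    X.Expands ↔ ∀ p ∈ M.beh, ∀ q ∈ M'.beh,
      WeakOrth (X.restrictLeft p) (X.restrictRight q) ∧ X.Anchored p q := by
  constructor
  · rintro h _ ⟨σ, rfl⟩ _ ⟨σ', rfl⟩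
    obtain ⟨τ, hτ⟩ := X.switchingEquiv.surjective (σ, σ')
    have h1 := (X.test_comp_acyclic_iff hM hM' τ).1 (h.acyclic τ)
    have h2 := (X.test_comp_connected_iff hM hM' τ).1 (h.connected τ)
    rw [hτ] at h1 h2
    exact ⟨h1, h2⟩
  · intro h
    exact ⟨X.comp_isLinear hM.linear hM'.linear,
      fun σ => (X.test_comp_acyclic_iff hM hM' σ).2 (h _ ⟨_, rfl⟩ _ ⟨_, rfl⟩).1,
      fun σ => (X.test_comp_connected_iff hM hM' σ).2 (h _ ⟨_, rfl⟩ _ ⟨_, rfl⟩).2⟩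

theorem k_le_ncard_outputs [Finite V'] : X.k ≤ M'.outputs.ncard := by
  have h : Set.range X.h ⊆ M'.outputs := by
    rintro _ ⟨j, rfl⟩
    exact X.h_mem j
  calc X.k = (Set.range X.h).ncard := by
        rw [← Set.image_univ, Set.ncard_image_of_injective _ X.h.injective, Set.ncard_univ]; simp
    _ ≤ _ := Set.ncard_le_ncard h (Set.toFinite _)

theorem size_restrictedGraph_le [Finite V'] (p : Setoid M.border) (q : Setoid M'.border) :
    (X.restrictedGraph p q).size ≤ 3 * M'.outputs.ncard := by
  have hp := Nat.card_le_card_of_surjective _ (Quotient.mk_surjective (s := X.restrictLeft p))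
  have hq := Nat.card_le_card_of_surjective _ (Quotient.mk_surjective (s := X.restrictRight q))
  have hk := X.k_le_ncard_outputs
  rw [UHypergraph.size, Nat.card_sum]
  simp only [Nat.card_eq_fintype_card (α := Fin X.k), Fintype.card_fin] at hp hq ⊢
  omega

end Interface

/-! ### Running times on the machine -/

/-- The program `c`, started in the state `s`, halts within `t` steps in a state satisfying `Q`. -/
def HaltsWithin (I : List (List ℕ)) (c : Cmd) (s : RamState) (t : ℕ) (Q : RamState → Prop) : Prop :=
  ∃ t' s', t' ≤ t ∧ Exec I c s t' s' ∧ Q s'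

namespace HaltsWithin

variable {I : List (List ℕ)} {s : RamState} {Q Q' : RamState → Prop}

theorem mono {c : Cmd} {t t' : ℕ} (h : HaltsWithin I c s t Q) (ht : t ≤ t')
    (hQ : ∀ s', Q s' → Q' s') : HaltsWithin I c s t' Q' := by
  obtain ⟨u, s', hu, hs', hQs'⟩ := h
  exact ⟨u, s', hu.trans ht, hs', hQ s' hQs'⟩

theorem const {d n : ℕ} (h : Q (s.setReg d n)) : HaltsWithin I (.const d n) s 1 Q :=
  ⟨1, _, le_rfl, .const d n s, h⟩

theorem add {d a b : ℕ} (h : Q (s.setReg d (s.reg a + s.reg b))) :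
    HaltsWithin I (.add d a b) s 1 Q :=
  ⟨1, _, le_rfl, .add d a b s, h⟩

theorem sub {d a b : ℕ} (h : Q (s.setReg d (s.reg a - s.reg b))) :
    HaltsWithin I (.sub d a b) s 1 Q :=
  ⟨1, _, le_rfl, .sub d a b s, h⟩

theorem load {d a : ℕ} (h : Q (s.setReg d (s.mem (s.reg a)))) :
    HaltsWithin I (.load d a) s 1 Q :=
  ⟨1, _, le_rfl, .load d a s, h⟩

theorem store {a b : ℕ} (h : Q (s.setMem (s.reg a) (s.reg b))) :
    HaltsWithin I (.store a b) s 1 Q :=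
  ⟨1, _, le_rfl, .store a b s, h⟩

theorem read {A d a : ℕ} (h : Q (s.setReg d ((I.getD A []).getD (s.reg a) 0))) :
    HaltsWithin I (.read A d a) s 1 Q :=
  ⟨1, _, le_rfl, .read A d a s, h⟩

theorem seq {c c' : Cmd} {t t' : ℕ}
    (h : HaltsWithin I c s t fun s' => HaltsWithin I c' s' t' Q) :
    HaltsWithin I (.seq c c') s (t + t') Q := by
  obtain ⟨u, s', hu, hs', u', s'', hu', hs'', hQ⟩ := h
  exact ⟨u + u', s'', add_le_add hu hu', .seq hs' hs'', hQ⟩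

theorem cond {a : ℕ} {c c' : Cmd} {t : ℕ} (h : s.reg a ≠ 0 → HaltsWithin I c s t Q)
    (h' : s.reg a = 0 → HaltsWithin I c' s t Q) : HaltsWithin I (.cond a c c') s (1 + t) Q := by
  by_cases ha : s.reg a = 0
  · obtain ⟨u, s', hu, hs', hQ⟩ := h' ha
    exact ⟨1 + u, s', by omega, .cond_false ha hs', hQ⟩
  · obtain ⟨u, s', hu, hs', hQ⟩ := h ha
    exact ⟨1 + u, s', by omega, .cond_true ha hs', hQ⟩

end HaltsWithin

/-- The entry with index `i` of the input array number `A`, `0` if there is none. -/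
def entry (I : List (List ℕ)) (A i : ℕ) : ℕ := (I.getD A []).getD i 0

/-- Repeat `c` as many times as the input entry `A`, `i` says.  The number of repetitions is in the
register `d`, the number of those already done in the register `d + 1`, and the register `d + 2`
controls the loop; of these three, `c` may only change the last one. -/
def countLoop (A i d : ℕ) (c : Cmd) : Cmd :=
  .seq (.const d i) <| .seq (.read A d d) <| .seq (.const (d + 1) 0) <|
    .seq (.sub (d + 2) d (d + 1)) <| .loop (d + 2) <|
      .seq c <| .seq (.const (d + 2) 1) <| .seq (.add (d + 1) (d + 1) (d + 2)) <|
        .sub (d + 2) d (d + 1)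

namespace RamState

@[simp] theorem setReg_mem (s : RamState) (d x : ℕ) : (s.setReg d x).mem = s.mem := rfl

@[simp] theorem setMem_reg (s : RamState) (d x : ℕ) : (s.setMem d x).reg = s.reg := rfl

@[simp] theorem setMem_mem (s : RamState) (d x : ℕ) :
    (s.setMem d x).mem = Function.update s.mem d x := rfl

theorem setReg_reg (s : RamState) (d x r : ℕ) :
    (s.setReg d x).reg r = if r = d then x else s.reg r :=
  Function.update_apply _ _ _ _

@[simp] theorem setReg_reg_self (s : RamState) (d x : ℕ) : (s.setReg d x).reg d = x := by
  simp [setReg_reg]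

theorem setReg_reg_of_ne (s : RamState) {d x r : ℕ} (h : r ≠ d) :
    (s.setReg d x).reg r = s.reg r := by
  simp [setReg_reg, h]

end RamState

/-- The rule for counting loops.  The invariant `Inv` speaks about the memory and the registers
other than the three that control the loop. -/
theorem HaltsWithin.countLoop {I : List (List ℕ)} {A i d t : ℕ} {c : Cmd}
    (Inv : ℕ → RamState → Prop)
    (hreg : ∀ j s r x, d ≤ r → r ≤ d + 2 → Inv j s → Inv j (s.setReg r x))
    (hc : ∀ j s, j < entry I A i → Inv j s → s.reg (d + 1) = j →
      HaltsWithin I c s t fun s' => Inv (j + 1) s' ∧ ∀ r < d + 2, d ≤ r → s'.reg r = s.reg r)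
    {s : RamState} (hs : Inv 0 s) :
    HaltsWithin I (_root_.countLoop A i d c) s (entry I A i * (t + 4) + 5)
      (Inv (entry I A i)) := by
  have main : ∀ n j s, j + n = entry I A i → Inv j s → s.reg d = entry I A i →
      s.reg (d + 1) = j → s.reg (d + 2) = n →
      HaltsWithin I (.loop (d + 2) <| .seq c <| .seq (.const (d + 2) 1) <|
        .seq (.add (d + 1) (d + 1) (d + 2)) <| .sub (d + 2) d (d + 1)) s (n * (t + 4) + 1)
        (Inv (entry I A i)) := by
    intro n
    induction n with
    | zero =>
      intro j s hj hInv h0 h1 h2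
      obtain rfl : j = entry I A i := by omega
      exact ⟨1, s, by omega, .loop_done h2, hInv⟩
    | succ n ih =>
      intro j s hj hInv h0 h1 h2
      have hbody : HaltsWithin I (.seq c <| .seq (.const (d + 2) 1) <|
          .seq (.add (d + 1) (d + 1) (d + 2)) <| .sub (d + 2) d (d + 1)) s (t + (1 + (1 + 1)))
          fun s' => Inv (j + 1) s' ∧ s'.reg d = entry I A i ∧ s'.reg (d + 1) = j + 1 ∧
            s'.reg (d + 2) = n := by
        refine .seq ((hc j s (by omega) hInv h1).mono le_rfl ?_)
        rintro s' ⟨hs', hr⟩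
        refine .seq (.const (.seq (.add (.sub ⟨?_, ?_⟩))))
        · exact hreg _ _ _ _ (by omega) (by omega) <| hreg _ _ _ _ (by omega) (by omega) <|
            hreg _ _ _ _ (by omega) (by omega) hs'
        · have h0' := hr d (by omega) (by omega)
          have h1' := hr (d + 1) (by omega) (by omega)
          simp only [RamState.setReg_reg, h0', h1', h0, h1]
          simp
          omega
      obtain ⟨u, s', hu, hs', hI, h0', h1', h2'⟩ := hbody
      obtain ⟨u', s'', hu', hs'', hQ⟩ := ih (j + 1) s' (by omega) hI h0' h1' h2'
      refine ⟨1 + u + u', s'', ?_, .loop_step (by omega) hs' hs'', hQ⟩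
      rw [add_mul]; omega
  have hstart : HaltsWithin I (_root_.countLoop A i d c) s
      (1 + (1 + (1 + (1 + (entry I A i * (t + 4) + 1))))) (Inv (entry I A i)) := by
    refine .seq (.const (.seq (.read (.seq (.const (.seq (.sub ?_)))))))
    refine main (entry I A i) 0 _ (by omega) ?_ ?_ ?_ ?_
    · exact hreg _ _ _ _ (by omega) (by omega) <| hreg _ _ _ _ (by omega) (by omega) <|
        hreg _ _ _ _ (by omega) (by omega) <| hreg _ _ _ _ (by omega) (by omega) hs
    all_goals simp [RamState.setReg_reg, entry]
  exact hstart.mono (by omega) fun _ h => h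

/-! ### A language of bounded loops -/

/-- Numerical expressions that may use variables, the work memory, the input arrays, and sums whose
number of terms is an entry of the input. -/
inductive Expression : Type
  | lit (n : ℕ)
  | var (x : ℕ)
  | add (a b : Expression)
  | sub (a b : Expression)
  | mem (a : Expression)
  | read (A : ℕ) (a : Expression)
  /-- `a` if `c ≠ 0`, and `b` otherwise -/
  | ite (c a b : Expression)
  /-- the sum of the values of `a` when `x` ranges over the numbers smaller than the input entry
  `A`, `i` -/
  | sum (x A i : ℕ) (a : Expression)

/-- Programs which modify the memory only.  Variables are introduced by `bind` and by the loops, and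
keep their value in their scope. -/
inductive Prog : Type
  | store (a b : Expression)
  | seq (c c' : Prog)
  | bind (x : ℕ) (a : Expression) (c : Prog)
  /-- `c` for each value of `x` smaller than the input entry `A`, `i` -/
  | loop (x A i : ℕ) (c : Prog)

namespace Expression

/-- The value of an expression, for the memory `m` and the values `v` of the variables. -/
def eval (I : List (List ℕ)) (m : ℕ → ℕ) : Expression → (ℕ → ℕ) → ℕ
  | lit n, _ => n
  | var x, v => v x
  | add a b, v => a.eval I m v + b.eval I m v
  | sub a b, v => a.eval I m v - b.eval I m v
  | mem a, v => m (a.eval I m v)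
  | read A a, v => entry I A (a.eval I m v)
  | ite c a b, v => if c.eval I m v ≠ 0 then a.eval I m v else b.eval I m v
  | sum x A i a, v => ∑ j ∈ Finset.range (entry I A i), a.eval I m (Function.update v x j)

/-- All sums have at most `N` terms. -/
def LoopsLE (I : List (List ℕ)) (N : ℕ) : Expression → Prop
  | lit _ => True
  | var _ => True
  | add a b => a.LoopsLE I N ∧ b.LoopsLE I N
  | sub a b => a.LoopsLE I N ∧ b.LoopsLE I N
  | mem a => a.LoopsLE I N
  | read _ a => a.LoopsLE I N
  | ite c a b => c.LoopsLE I N ∧ a.LoopsLE I N ∧ b.LoopsLE I N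
  | sum _ A i a => entry I A i ≤ N ∧ a.LoopsLE I N

/-- Machine code that computes the value of an expression in the register `d`.  The variable `x` is
held in the register `ρ x < d`; registers from `d` on are free. -/
def compile : Expression → (ρ : ℕ → ℕ) → (d : ℕ) → Cmd
  | lit n, _, d => .const d n
  | var x, ρ, d => .seq (.const (d + 1) 0) (.add d (ρ x) (d + 1))
  | add a b, ρ, d => .seq (a.compile ρ d) (.seq (b.compile ρ (d + 1)) (.add d d (d + 1)))
  | sub a b, ρ, d => .seq (a.compile ρ d) (.seq (b.compile ρ (d + 1)) (.sub d d (d + 1)))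
  | mem a, ρ, d => .seq (a.compile ρ d) (.load d d)
  | read A a, ρ, d => .seq (a.compile ρ d) (.read A d d)
  | ite c a b, ρ, d => .seq (c.compile ρ d) (.cond d (a.compile ρ d) (b.compile ρ d))
  | sum x A i a, ρ, d => .seq (.const d 0) <| countLoop A i (d + 1) <|
      .seq (a.compile (Function.update ρ x (d + 2)) (d + 4)) (.add d d (d + 4))

/-- The running time of the machine code, as a polynomial in a bound on the length of the sums. -/
noncomputable def cost : Expression → Polynomial ℕ
  | lit _ => 1
  | var _ => 2
  | add a b => a.cost + b.cost + 1
  | sub a b => a.cost + b.cost + 1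
  | mem a => a.cost + 1
  | read _ a => a.cost + 1
  | ite c a b => c.cost + (1 + (a.cost + b.cost))
  | sum _ _ _ a => Polynomial.X * (a.cost + 5) + 6

theorem haltsWithin_compile (I : List (List ℕ)) (N : ℕ) (m : ℕ → ℕ) (a : Expression) :
    ∀ (v ρ : ℕ → ℕ) (d : ℕ) (s : RamState), a.LoopsLE I N → s.mem = m →
      (∀ y, ρ y < d) → (∀ y, s.reg (ρ y) = v y) →
      HaltsWithin I (a.compile ρ d) s (a.cost.eval N) fun s' =>
        s'.reg d = a.eval I m v ∧ s'.mem = m ∧ ∀ r < d, s'.reg r = s.reg r := by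
  have frame : ∀ {ρ v : ℕ → ℕ} {d : ℕ} {s s' : RamState}, (∀ y, ρ y < d) →
      (∀ y, s.reg (ρ y) = v y) → (∀ r < d, s'.reg r = s.reg r) → ∀ y, s'.reg (ρ y) = v y :=
    fun hρ hv h y => (h _ (hρ y)).trans (hv y)
  induction a with
  | lit n =>
    intro v ρ d s _ hm _ _
    refine (HaltsWithin.const ?_).mono (by simp [cost]) fun _ h => h
    exact ⟨by simp [eval], hm, fun r hr => s.setReg_reg_of_ne hr.ne⟩
  | var x =>
    intro v ρ d s _ hm hρ hv
    refine (HaltsWithin.seq (.const (.add ?_))).mono (t := 1 + 1) (by simp [cost]) fun _ h => h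
    have h1 := hρ x
    refine ⟨?_, hm, fun r hr => ?_⟩
    · simp [RamState.setReg_reg, eval, hv x, show ρ x ≠ d + 1 by omega]
    · simp [RamState.setReg_reg, hr.ne, show r ≠ d + 1 by omega]
  | add a b iha ihb =>
    intro v ρ d s hl hm hρ hv
    refine (HaltsWithin.seq ((iha v ρ d s hl.1 hm hρ hv).mono le_rfl ?_)).mono
      (t := a.cost.eval N + (b.cost.eval N + 1)) (by simp [cost, add_assoc]) fun _ h => h
    rintro s₁ ⟨h1, hm1, hr1⟩
    refine .seq ((ihb v ρ (d + 1) s₁ hl.2 hm1 (fun y => (hρ y).trans (by omega))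
      (frame hρ hv hr1)).mono le_rfl ?_)
    rintro s₂ ⟨h2, hm2, hr2⟩
    refine .add ⟨?_, hm2, fun r hr => ?_⟩
    · simp [eval, h2, hr2 d (by omega), h1]
    · rw [RamState.setReg_reg_of_ne _ hr.ne, hr2 r (by omega), hr1 r hr]
  | sub a b iha ihb =>
    intro v ρ d s hl hm hρ hv
    refine (HaltsWithin.seq ((iha v ρ d s hl.1 hm hρ hv).mono le_rfl ?_)).mono
      (t := a.cost.eval N + (b.cost.eval N + 1)) (by simp [cost, add_assoc]) fun _ h => h
    rintro s₁ ⟨h1, hm1, hr1⟩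
    refine .seq ((ihb v ρ (d + 1) s₁ hl.2 hm1 (fun y => (hρ y).trans (by omega))
      (frame hρ hv hr1)).mono le_rfl ?_)
    rintro s₂ ⟨h2, hm2, hr2⟩
    refine .sub ⟨?_, hm2, fun r hr => ?_⟩
    · simp [eval, h2, hr2 d (by omega), h1]
    · rw [RamState.setReg_reg_of_ne _ hr.ne, hr2 r (by omega), hr1 r hr]
  | mem a iha =>
    intro v ρ d s hl hm hρ hv
    refine (HaltsWithin.seq ((iha v ρ d s hl hm hρ hv).mono le_rfl ?_)).mono
      (t := a.cost.eval N + 1) (by simp [cost]) fun _ h => h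
    rintro s₁ ⟨h1, hm1, hr1⟩
    refine .load ⟨?_, hm1, fun r hr => ?_⟩
    · simp [eval, h1, hm1]
    · rw [RamState.setReg_reg_of_ne _ hr.ne, hr1 r hr]
  | read A a iha =>
    intro v ρ d s hl hm hρ hv
    refine (HaltsWithin.seq ((iha v ρ d s hl hm hρ hv).mono le_rfl ?_)).mono
      (t := a.cost.eval N + 1) (by simp [cost]) fun _ h => h
    rintro s₁ ⟨h1, hm1, hr1⟩
    refine .read ⟨?_, hm1, fun r hr => ?_⟩
    · simp [eval, h1, entry]
    · rw [RamState.setReg_reg_of_ne _ hr.ne, hr1 r hr]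
  | ite c a b ihc iha ihb =>
    intro v ρ d s hl hm hρ hv
    refine (HaltsWithin.seq ((ihc v ρ d s hl.1 hm hρ hv).mono le_rfl ?_)).mono
      (t := c.cost.eval N + (1 + (a.cost.eval N + b.cost.eval N))) (by simp [cost]) fun _ h => h
    rintro s₁ ⟨h1, hm1, hr1⟩
    refine .cond (fun h => ?_) (fun h => ?_)
    · refine (iha v ρ d s₁ hl.2.1 hm1 hρ (frame hρ hv hr1)).mono (by omega) ?_
      rintro s₂ ⟨h2, hm2, hr2⟩
      exact ⟨by rw [h2, eval, if_pos (h1 ▸ h)], hm2, fun r hr => (hr2 r hr).trans (hr1 r hr)⟩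
    · refine (ihb v ρ d s₁ hl.2.2 hm1 hρ (frame hρ hv hr1)).mono (by omega) ?_
      rintro s₂ ⟨h2, hm2, hr2⟩
      exact ⟨by rw [h2, eval, if_neg (not_not.2 (h1 ▸ h))], hm2,
        fun r hr => (hr2 r hr).trans (hr1 r hr)⟩
  | sum x A i a iha =>
    intro v ρ d s hl hm hρ hv
    let Inv : ℕ → RamState → Prop := fun j s' =>
      s'.reg d = ∑ j ∈ Finset.range j, a.eval I m (Function.update v x j) ∧ s'.mem = m ∧
        ∀ r < d, s'.reg r = s.reg r
    refine (HaltsWithin.seq (t := 1) (.const (HaltsWithin.countLoop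
      (t := a.cost.eval N + 1) Inv ?_ ?_ ?_))).mono ?_ ?_
    · rintro j s' r y hr _ ⟨h1, h2, h3⟩
      refine ⟨?_, h2, fun r' hr' => ?_⟩
      · rw [RamState.setReg_reg_of_ne _ (by omega), h1]
      · rw [RamState.setReg_reg_of_ne _ (by omega), h3 r' hr']
    · rintro j s' _ ⟨h1, h2, h3⟩ hj
      refine .seq ((iha (Function.update v x j) (Function.update ρ x (d + 2)) (d + 4) s' hl.2 h2
        (fun y => ?_) (fun y => ?_)).mono le_rfl ?_)
      · rcases eq_or_ne y x with rfl | hy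
        · simp
        · rw [Function.update_of_ne hy]; exact (hρ y).trans (by omega)
      · rcases eq_or_ne y x with rfl | hy
        · simpa using hj
        · rw [Function.update_of_ne hy, Function.update_of_ne hy, h3 _ (hρ y), hv]
      · rintro s₁ ⟨k1, k2, k3⟩
        refine .add ⟨⟨?_, k2, fun r hr => ?_⟩, fun r hr hr' => ?_⟩
        · rw [RamState.setReg_reg_self, k3 d (by omega), h1, k1, Finset.sum_range_succ]
        · rw [RamState.setReg_reg_of_ne _ hr.ne, k3 r (by omega), h3 r hr]
        · rw [RamState.setReg_reg_of_ne _ (by omega), k3 r (by omega)]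
    · exact ⟨by simp, hm, fun r hr => s.setReg_reg_of_ne hr.ne⟩
    · have := Nat.mul_le_mul_right (a.cost.eval N + 1 + 4) hl.1
      rw [show a.cost.eval N + 1 + 4 = a.cost.eval N + 5 from rfl] at this ⊢
      simp only [cost, Polynomial.eval_add, Polynomial.eval_mul, Polynomial.eval_X,
        Polynomial.eval_ofNat]
      omega
    · exact fun s' h => h

end Expression

namespace Prog

/-- The memory after the execution of a program, for the memory `m` and the values `v` of the
variables. -/
def run (I : List (List ℕ)) : Prog → (v m : ℕ → ℕ) → ℕ → ℕ
  | store a b, v, m => Function.update m (a.eval I m v) (b.eval I m v)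
  | seq c c', v, m => c'.run I v (c.run I v m)
  | bind x a c, v, m => c.run I (Function.update v x (a.eval I m v)) m
  | loop x A i c, v, m =>
      Nat.rec m (fun j m => c.run I (Function.update v x j) m) (entry I A i)

/-- All sums and all loops have at most `N` rounds. -/
def LoopsLE (I : List (List ℕ)) (N : ℕ) : Prog → Prop
  | store a b => a.LoopsLE I N ∧ b.LoopsLE I N
  | seq c c' => c.LoopsLE I N ∧ c'.LoopsLE I N
  | bind _ a c => a.LoopsLE I N ∧ c.LoopsLE I N
  | loop _ A i c => entry I A i ≤ N ∧ c.LoopsLE I N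

/-- Machine code for a program.  The variable `x` is held in the register `ρ x < d`; registers from
`d` on are free. -/
def compile : Prog → (ρ : ℕ → ℕ) → (d : ℕ) → Cmd
  | store a b, ρ, d => .seq (a.compile ρ d) (.seq (b.compile ρ (d + 1)) (.store d (d + 1)))
  | seq c c', ρ, d => .seq (c.compile ρ d) (c'.compile ρ d)
  | bind x a c, ρ, d => .seq (a.compile ρ d) (c.compile (Function.update ρ x d) (d + 1))
  | loop x A i c, ρ, d => countLoop A i d (c.compile (Function.update ρ x (d + 1)) (d + 3))

/-- The running time of the machine code, as a polynomial in a bound on the length of the loops. -/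
noncomputable def cost : Prog → Polynomial ℕ
  | store a b => a.cost + b.cost + 1
  | seq c c' => c.cost + c'.cost
  | bind _ a c => a.cost + c.cost
  | loop _ _ _ c => Polynomial.X * (c.cost + 4) + 5

theorem haltsWithin_compile (I : List (List ℕ)) (N : ℕ) (c : Prog) :
    ∀ (m v ρ : ℕ → ℕ) (d : ℕ) (s : RamState), c.LoopsLE I N → s.mem = m →
      (∀ y, ρ y < d) → (∀ y, s.reg (ρ y) = v y) →
      HaltsWithin I (c.compile ρ d) s (c.cost.eval N) fun s' =>
        s'.mem = c.run I v m ∧ ∀ r < d, s'.reg r = s.reg r := by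
  have frame : ∀ {ρ v : ℕ → ℕ} {d : ℕ} {s s' : RamState}, (∀ y, ρ y < d) →
      (∀ y, s.reg (ρ y) = v y) → (∀ r < d, s'.reg r = s.reg r) → ∀ y, s'.reg (ρ y) = v y :=
    fun hρ hv h y => (h _ (hρ y)).trans (hv y)
  induction c with
  | store a b =>
    intro m v ρ d s hl hm hρ hv
    refine (HaltsWithin.seq ((a.haltsWithin_compile I N m v ρ d s hl.1 hm hρ hv).mono le_rfl
      ?_)).mono (t := a.cost.eval N + (b.cost.eval N + 1)) (by simp [cost, add_assoc]) fun _ h => h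
    rintro s₁ ⟨h1, hm1, hr1⟩
    refine .seq ((b.haltsWithin_compile I N m v ρ (d + 1) s₁ hl.2 hm1
      (fun y => (hρ y).trans (by omega)) (frame hρ hv hr1)).mono le_rfl ?_)
    rintro s₂ ⟨h2, hm2, hr2⟩
    refine .store ⟨?_, fun r hr => ?_⟩
    · simp [run, h2, hr2 d (by omega), h1, hm2]
    · rw [RamState.setMem_reg, hr2 r (by omega), hr1 r hr]
  | seq c c' ih ih' =>
    intro m v ρ d s hl hm hρ hv
    refine (HaltsWithin.seq ((ih m v ρ d s hl.1 hm hρ hv).mono le_rfl ?_)).mono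
      (t := c.cost.eval N + c'.cost.eval N) (by simp [cost]) fun _ h => h
    rintro s₁ ⟨hm1, hr1⟩
    refine (ih' _ v ρ d s₁ hl.2 hm1 hρ (frame hρ hv hr1)).mono le_rfl ?_
    rintro s₂ ⟨hm2, hr2⟩
    exact ⟨hm2, fun r hr => (hr2 r hr).trans (hr1 r hr)⟩
  | bind x a c ih =>
    intro m v ρ d s hl hm hρ hv
    refine (HaltsWithin.seq ((a.haltsWithin_compile I N m v ρ d s hl.1 hm hρ hv).mono le_rfl
      ?_)).mono (t := a.cost.eval N + c.cost.eval N) (by simp [cost]) fun _ h => h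
    rintro s₁ ⟨h1, hm1, hr1⟩
    refine (ih m (Function.update v x (a.eval I m v)) _ (d + 1) s₁ hl.2 hm1 (fun y => ?_)
      (fun y => ?_)).mono le_rfl ?_
    · rcases eq_or_ne y x with rfl | hy
      · simp
      · rw [Function.update_of_ne hy]; exact (hρ y).trans (by omega)
    · rcases eq_or_ne y x with rfl | hy
      · simpa using h1
      · rw [Function.update_of_ne hy, Function.update_of_ne hy, hr1 _ (hρ y), hv]
    · rintro s₂ ⟨hm2, hr2⟩
      exact ⟨hm2, fun r hr => (hr2 r (by omega)).trans (hr1 r hr)⟩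
  | loop x A i c ih =>
    intro m v ρ d s hl hm hρ hv
    let Inv : ℕ → RamState → Prop := fun j s' =>
      s'.mem = Nat.rec m (fun j m => c.run I (Function.update v x j) m) j ∧
        ∀ r < d, s'.reg r = s.reg r
    refine (HaltsWithin.countLoop (t := c.cost.eval N) Inv ?_ ?_ ?_).mono ?_ fun s' h => h
    · rintro j s' r y hr _ ⟨h1, h2⟩
      exact ⟨h1, fun r' hr' => by rw [RamState.setReg_reg_of_ne _ (by omega), h2 r' hr']⟩
    · rintro j s' _ ⟨h1, h2⟩ hj
      refine (ih _ (Function.update v x j) (Function.update ρ x (d + 1)) (d + 3) s' hl.2 h1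
        (fun y => ?_) (fun y => ?_)).mono le_rfl ?_
      · rcases eq_or_ne y x with rfl | hy
        · simp
        · rw [Function.update_of_ne hy]; exact (hρ y).trans (by omega)
      · rcases eq_or_ne y x with rfl | hy
        · simpa using hj
        · rw [Function.update_of_ne hy, Function.update_of_ne hy, h2 _ (hρ y), hv]
      · rintro s₁ ⟨k1, k2⟩
        exact ⟨⟨k1, fun r hr => (k2 r (by omega)).trans (h2 r hr)⟩,
          fun r hr _ => k2 r (by omega)⟩
    · exact ⟨hm, fun r hr => rfl⟩
    · have := Nat.mul_le_mul_right (c.cost.eval N + 4) hl.1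
      simp only [cost, Polynomial.eval_add, Polynomial.eval_mul, Polynomial.eval_X,
        Polynomial.eval_ofNat]
      omega

/-- The rule for loops: an invariant of the memory. -/
theorem run_loop {I : List (List ℕ)} {x A i : ℕ} {c : Prog} {v m : ℕ → ℕ}
    (Inv : ℕ → (ℕ → ℕ) → Prop) (h0 : Inv 0 m)
    (hc : ∀ j < entry I A i, ∀ m, Inv j m → Inv (j + 1) (c.run I (Function.update v x j) m)) :
    Inv (entry I A i) ((loop x A i c).run I v m) := by
  have : ∀ j ≤ entry I A i,
      Inv j (Nat.rec m (fun j m => c.run I (Function.update v x j) m) j) := by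
    intro j
    induction j with
    | zero => exact fun _ => h0
    | succ j ih => exact fun hj => hc j (by omega) _ (ih (by omega))
  exact this _ le_rfl

/-- Machine code that runs a program and returns `1` if it leaves `0` in the memory cell `0`, and
`0` otherwise. -/
def decider (c : Prog) : Cmd :=
  .seq (c.compile (fun _ => 0) 1) <| .seq (.const 1 0) <| .seq (.load 1 1) <|
    .seq (.const 0 1) (.sub 0 0 1)

/-- A program that leaves `0` in the memory cell `0` exactly when `Q` holds gives a decision
procedure for `Q`. -/
theorem decidesWithin {I : List (List ℕ)} {N : ℕ} {c : Prog} {Q : Prop} (hl : c.LoopsLE I N)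
    (hQ : c.run I (fun _ => 0) (fun _ => 0) 0 = 0 ↔ Q) :
    DecidesWithin c.decider I ((c.cost + 4).eval N) Q := by
  have h : HaltsWithin I c.decider RamState.init
      (c.cost.eval N + (1 + (1 + (1 + 1)))) fun s =>
        s.reg 0 = 1 - c.run I (fun _ => 0) (fun _ => 0) 0 := by
    refine .seq ((c.haltsWithin_compile I N (fun _ => 0) (fun _ => 0) (fun _ => 0) 1
      RamState.init hl rfl (fun _ => one_pos) (fun _ => rfl)).mono le_rfl ?_)
    rintro s ⟨hs, -⟩
    refine .seq (.const (.seq (.load (.seq (.const (.sub ?_))))))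
    simp [RamState.setReg_reg, hs]
  obtain ⟨t, s, ht, hs, h0⟩ := h
  refine ⟨t, s, ht.trans (by simp), hs, fun q => ?_, fun q => ?_⟩
  · rw [h0, hQ.2 q]
  · have : c.run I (fun _ => 0) (fun _ => 0) 0 ≠ 0 := fun h => q (hQ.1 h)
    omega

end Prog

/-! ### Contracting the edges of a multigraph one by one -/

/-- `A j` and `B j` are the ends of the edge `j` of a multigraph whose vertices are numbers.  The
edges `i, …, k - 1` form a forest, in the form that every labelling of them is the coboundary of a
potential on the vertices. -/
def IsForestFrom (A B : ℕ → ℕ) (k i : ℕ) : Prop :=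
  ∀ f : ℕ → ZMod 2, ∃ φ : ℕ → ZMod 2, ∀ j, i ≤ j → j < k → φ (A j) + φ (B j) = f j

/-- Every connected component of the multigraph with edges `i, …, k - 1` that contains one of the
vertices `A j` contains one with `S j`. -/
def IsAnchoredFrom (A B : ℕ → ℕ) (S : ℕ → Prop) (k i : ℕ) : Prop :=
  ∀ φ : ℕ → Prop, (∀ j, i ≤ j → j < k → (φ (A j) ↔ φ (B j))) → (∀ j < k, S j → ¬ φ (A j)) →
    ∀ j < k, ¬ φ (A j)

/-- Identify the vertex `x` with the vertex `y`. -/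
def relabel (x y z : ℕ) : ℕ := if z = x then y else z

theorem IsForestFrom.congr {A B A' B' : ℕ → ℕ} {k i : ℕ} (hA : ∀ j < k, A j = A' j)
    (hB : ∀ j < k, B j = B' j) : IsForestFrom A B k i ↔ IsForestFrom A' B' k i :=
  forall_congr' fun _ => exists_congr fun _ => forall_congr' fun j => forall_congr' fun _ =>
    forall_congr' fun hj => by rw [hA j hj, hB j hj]

theorem IsAnchoredFrom.congr {A B A' B' : ℕ → ℕ} {S : ℕ → Prop} {k i : ℕ}
    (hA : ∀ j < k, A j = A' j) (hB : ∀ j < k, B j = B' j) :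
    IsAnchoredFrom A B S k i ↔ IsAnchoredFrom A' B' S k i := by
  refine forall_congr' fun φ => imp_congr (forall_congr' fun j => forall_congr' fun _ =>
    forall_congr' fun hj => by rw [hA j hj, hB j hj]) (imp_congr ?_ ?_)
  · exact forall_congr' fun j => forall_congr' fun hj => by rw [hA j hj]
  · exact forall_congr' fun j => forall_congr' fun hj => by rw [hA j hj]

/-- Contraction of an edge: a potential on the contracted graph lifts, since the value at one end of
the edge can be shifted, and a loop has no potential for the label `1`. -/
theorem isForestFrom_iff_relabel {A B : ℕ → ℕ} {k i : ℕ} (hi : i < k) :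
    IsForestFrom A B k i ↔ A i ≠ B i ∧
      IsForestFrom (fun j => relabel (A i) (B i) (A j)) (fun j => relabel (A i) (B i) (B j))
        k (i + 1) := by
  constructor
  · intro h
    refine ⟨fun hAB => ?_, fun f => ?_⟩
    · obtain ⟨φ, hφ⟩ := h fun _ => 1
      have := hφ i le_rfl hi
      rw [hAB, CharTwo.add_self_eq_zero] at this
      exact zero_ne_one this
    · obtain ⟨φ, hφ⟩ := h fun j => if j = i then 0 else f j
      have hAB : φ (A i) = φ (B i) := CharTwo.add_eq_zero.1 (by simpa using hφ i le_rfl hi)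
      have hrel : ∀ z, φ (relabel (A i) (B i) z) = φ z := fun z => by
        unfold relabel; split_ifs with hz
        · rw [hz, hAB]
        · rfl
      refine ⟨φ, fun j hj hjk => ?_⟩
      rw [hrel, hrel, hφ j (by omega) hjk, if_neg (by omega)]
  · rintro ⟨hAB, h⟩ f
    -- A potential for the contracted graph, shifted at the vertex `A i` by the label of the
    -- edge `i`.
    let δ : ℕ → ZMod 2 := fun z => if z = A i then f i else 0
    obtain ⟨φ, hφ⟩ := h fun j => f j - δ (A j) - δ (B j)
    refine ⟨fun z => φ (relabel (A i) (B i) z) + δ z, fun j hj hjk => ?_⟩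
    rcases hj.eq_or_lt with rfl | hj
    · have h1 : relabel (A i) (B i) (A i) = B i := if_pos rfl
      have h2 : relabel (A i) (B i) (B i) = B i := if_neg hAB.symm
      have h3 : δ (A i) = f i := if_pos rfl
      have h4 : δ (B i) = 0 := if_neg hAB.symm
      dsimp only
      rw [h1, h2, h3, h4]
      linear_combination CharTwo.add_self_eq_zero (φ (B i))
    · linear_combination hφ j hj hjk

/-- Contraction of an edge does not change the unions of connected components. -/
theorem isAnchoredFrom_iff_relabel {A B : ℕ → ℕ} {S : ℕ → Prop} {k i : ℕ} (hi : i < k) :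
    IsAnchoredFrom A B S k i ↔
      IsAnchoredFrom (fun j => relabel (A i) (B i) (A j)) (fun j => relabel (A i) (B i) (B j))
        S k (i + 1) := by
  constructor
  · intro h φ hφ hS
    refine h (fun z => φ (relabel (A i) (B i) z)) (fun j hj hjk => ?_) hS
    rcases hj.eq_or_lt with rfl | hj
    · simp only [relabel, if_true]
      split_ifs <;> rfl
    · exact hφ j hj hjk
  · intro h φ hφ hS
    have hrel : ∀ z, φ (relabel (A i) (B i) z) ↔ φ z := fun z => by
      unfold relabel; split_ifs with hz
      · rw [hz, hφ i le_rfl hi]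
      · rfl
    simpa only [hrel] using h φ (fun j hj hjk => by
      rw [hrel, hrel]; exact hφ j (by omega) hjk) (by simpa only [hrel] using hS)

theorem isForestFrom_self (A B : ℕ → ℕ) (k : ℕ) : IsForestFrom A B k k :=
  fun _ => ⟨0, fun j hj hjk => absurd hjk (by omega)⟩

theorem isAnchoredFrom_self_iff {A B : ℕ → ℕ} {S : ℕ → Prop} {k : ℕ} :
    IsAnchoredFrom A B S k k ↔ ∀ i < k, ∃ j < k, A i = A j ∧ S j := by
  constructor
  · intro h i hi
    by_contra! hc
    exact h (fun z => A i = z) (fun j hj hjk => absurd hjk (by omega))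
      (fun j hj hS hij => hc j hj hij hS) i hi rfl
  · intro h φ _ hS i hi hφ
    obtain ⟨j, hj, hij, hSj⟩ := h i hi
    exact hS j hj hSj (hij ▸ hφ)

/-- The graph of incidence of two partitions of `Fin k`, with numbers for the blocks. -/
theorem weakOrth_iff_isForestFrom {k : ℕ} {p q : Setoid (Fin k)} {A B : ℕ → ℕ}
    (hA : ∀ i j : Fin k, A i = A j ↔ p i j) (hB : ∀ i j : Fin k, B i = B j ↔ q i j)
    (hAB : ∀ i j : Fin k, A i ≠ B j) : WeakOrth p q ↔ IsForestFrom A B k 0 := by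
  classical
  rw [weakOrth_iff_forall_exists_add]
  constructor
  · intro h f
    obtain ⟨a, b, ha, hb, hab⟩ := h fun i => f i
    obtain ⟨φ, hφ⟩ : ∃ φ : ℕ → ZMod 2, (∀ i : Fin k, φ (A i) = a i) ∧
        ∀ i : Fin k, φ (B i) = b i := by
      refine ⟨fun z => if h : ∃ i : Fin k, A i = z then a h.choose else
        if h : ∃ i : Fin k, B i = z then b h.choose else 0, fun i => ?_, fun i => ?_⟩
      · have h1 : ∃ j : Fin k, A j = A i := ⟨i, rfl⟩
        dsimp only
        rw [dif_pos h1]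
        exact ha _ _ ((hA _ _).1 h1.choose_spec)
      · have h1 : ∃ j : Fin k, B j = B i := ⟨i, rfl⟩
        have h2 : ¬ ∃ j : Fin k, A j = B i := fun ⟨j, hj⟩ => hAB j i hj
        dsimp only
        rw [dif_neg h2, dif_pos h1]
        exact hb _ _ ((hB _ _).1 h1.choose_spec)
    exact ⟨φ, fun j _ hj => by
      rw [← hab ⟨j, hj⟩, ← hφ.1 ⟨j, hj⟩, ← hφ.2 ⟨j, hj⟩]⟩
  · intro h f
    obtain ⟨φ, hφ⟩ := h fun j => if hj : j < k then f ⟨j, hj⟩ else 0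
    exact ⟨fun i => φ (A i), fun i => φ (B i), fun i j hij => by simp only [(hA i j).2 hij],
      fun i j hij => by simp only [(hB i j).2 hij], fun i => by simp [hφ i (Nat.zero_le _) i.2]⟩

theorem forall_invariant_iff_isAnchoredFrom {k : ℕ} {p q : Setoid (Fin k)} {A B : ℕ → ℕ}
    (hA : ∀ i j : Fin k, A i = A j ↔ p i j) (hB : ∀ i j : Fin k, B i = B j ↔ q i j)
    (hAB : ∀ i j : Fin k, A i ≠ B j) {S : Fin k → Prop} {S' : ℕ → Prop}
    (hS : ∀ i : Fin k, S' i ↔ S i) :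
    (∀ f : Fin k → Prop, (∀ i j, p i j → f i = f j) → (∀ i j, q i j → f i = f j) →
      (∀ j, S j → ¬ f j) → ∀ i, ¬ f i) ↔ IsAnchoredFrom A B S' k 0 := by
  constructor
  · intro h φ hφ hφS j hj
    refine h (fun j => φ (A j)) (fun i j hij => by simp only [(hA i j).2 hij])
      (fun i j hij => ?_) (fun j hj => hφS j j.2 ((hS j).2 hj)) ⟨j, hj⟩
    simp only [hφ i (Nat.zero_le _) i.2, hφ j (Nat.zero_le _) j.2, (hB i j).2 hij]
  · intro h f hp hq hfS i hi
    -- The union of the blocks of `p` and of `q` that are contained in `f`.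
    refine h (fun z => (∃ j : Fin k, A j = z ∧ f j) ∨ ∃ j : Fin k, B j = z ∧ f j)
      (fun j _ hj => ?_) (fun j hj hSj => ?_) i i.2 (Or.inl ⟨i, rfl, hi⟩)
    · have hl : ((∃ i : Fin k, A i = A j ∧ f i) ∨ ∃ i : Fin k, B i = A j ∧ f i) ↔ f ⟨j, hj⟩ := by
        constructor
        · rintro (⟨i, hi, hfi⟩ | ⟨i, hi, -⟩)
          · exact Eq.mp (hp i ⟨j, hj⟩ ((hA _ _).1 hi)) hfi
          · exact absurd hi.symm (hAB ⟨j, hj⟩ i)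
        · exact fun hf => Or.inl ⟨⟨j, hj⟩, rfl, hf⟩
      have hr : ((∃ i : Fin k, A i = B j ∧ f i) ∨ ∃ i : Fin k, B i = B j ∧ f i) ↔ f ⟨j, hj⟩ := by
        constructor
        · rintro (⟨i, hi, -⟩ | ⟨i, hi, hfi⟩)
          · exact absurd hi (hAB i ⟨j, hj⟩)
          · exact Eq.mp (hq i ⟨j, hj⟩ ((hB _ _).1 hi)) hfi
        · exact fun hf => Or.inr ⟨⟨j, hj⟩, rfl, hf⟩
      exact hl.trans hr.symm
    · rintro (⟨i, hi, hfi⟩ | ⟨i, hi, -⟩)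
      · exact hfS ⟨j, hj⟩ ((hS ⟨j, hj⟩).1 hSj) (Eq.mp (hp i ⟨j, hj⟩ ((hA _ _).1 hi)) hfi)
      · exact hAB ⟨j, hj⟩ i hi.symm

/-! ### The program -/

/-!
The input arrays are numbered as in `Tabulation.input`: `0` is the size of the interface, `1` and
`2` are the positions of its elements in the two borders, `3`, …, `7` are the tables of `M` and `8`,
…, `12` those of `M'`.  The variables `0` and `1` range over the partitions of `M` and of `M'`, and
the variables `2`, `3` and `7` over the interface; `4` and `5` are the ends of the edge being
contracted, and `6` is the summation variable of a product.

The memory cell `0` counts violations.  The edges are the elements of the interface, and the cells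
`1 + j` and `1 + k + j` hold the numbers of the two ends of the edge `j < k`.
-/

namespace Expression

/-- `1` if two expressions have the same value, and `0` otherwise. -/
def eq (a b : Expression) : Expression := ite (sub a b) (lit 0) (ite (sub b a) (lit 0) (lit 1))

/-- For a table of which the array `A` contains the number of columns and the number of rows, the
index of the first entry of the row whose number is the value of the variable `x`.  The machine has
no multiplication, so this product is computed as a sum over the rows that precede that row. -/
def rowStart (A x : ℕ) : Expression :=
  sum 6 A 1 (ite (sub (var x) (var 6)) (read A (lit 0)) (lit 0))

/-- The entry of the table `B` in the row whose number is the value of `x`, in the column whose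
number is the entry `j` of the array `P`. -/
def table (A B P x : ℕ) (j : Expression) : Expression :=
  read B (add (rowStart A x) (read P j))

/-- The difference between the size of the block of the `j`-th element of the interface and the
number of elements of the interface in that block, from the table `B` of the block numbers and the
table `B'` of the block sizes. -/
def outside (A B B' P x j : ℕ) : Expression :=
  sub (table A B' P x (var j))
    (sum 7 0 0 (eq (table A B P x (var 7)) (table A B P x (var j))))

/-- A number that is positive if and only if the `j`-th element of the interface escapes. -/
def escapes (j : ℕ) : Expression :=
  add (add (read 5 (read 1 (var j))) (read 9 (read 2 (var j))))
    (add (outside 3 6 7 1 0 j) (outside 8 11 12 2 1 j))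

/-- The address of the number of the end of the edge `j` that is a block of `p`. -/
def leftCell (j : ℕ) : Expression := add (lit 1) (var j)

/-- The address of the number of the end of the edge `j` that is a block of `q`. -/
def rightCell (j : ℕ) : Expression := add (add (lit 1) (read 0 (lit 0))) (var j)

variable {I : List (List ℕ)} {m v : ℕ → ℕ}

@[simp] theorem eval_eq (a b : Expression) :
    (eq a b).eval I m v = if a.eval I m v = b.eval I m v then 1 else 0 := by
  by_cases h : a.eval I m v = b.eval I m v
  · simp [eq, eval, h]
  · by_cases h' : a.eval I m v ≤ b.eval I m v
    · have h'' : b.eval I m v - a.eval I m v ≠ 0 := by omega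
      simp [eq, eval, h, h'']
    · have h'' : a.eval I m v - b.eval I m v ≠ 0 := by omega
      simp [eq, eval, h, h'']

theorem eval_rowStart {A x : ℕ} (hx : x ≠ 6) (h : v x ≤ entry I A 1) :
    (rowStart A x).eval I m v = v x * entry I A 0 := by
  have : ∀ n, v x ≤ n → (∑ j ∈ Finset.range n, if v x - j ≠ 0 then entry I A 0 else 0) =
      v x * entry I A 0 := by
    intro n hn
    rw [← Finset.sum_filter, Finset.sum_const, smul_eq_mul]
    congr 1
    rw [show (Finset.range n).filter (fun j => v x - j ≠ 0) = Finset.range (v x) by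
      ext j; simp; omega, Finset.card_range]
  simpa [rowStart, eval, Function.update_of_ne hx] using this _ h

theorem eval_table {A B P x : ℕ} {j : Expression} (hx : x ≠ 6) (h : v x ≤ entry I A 1) :
    (table A B P x j).eval I m v =
      entry I B (v x * entry I A 0 + entry I P (j.eval I m v)) := by
  rw [table, eval, eval, eval_rowStart hx h, eval]

theorem eval_outside {A B B' P x j : ℕ} (hx : x ≠ 6) (hx' : x ≠ 7) (hj : j ≠ 7)
    (h : v x ≤ entry I A 1) :
    (outside A B B' P x j).eval I m v =
      entry I B' (v x * entry I A 0 + entry I P (v j)) -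
        ∑ i ∈ Finset.range (entry I 0 0),
          if entry I B (v x * entry I A 0 + entry I P i) =
            entry I B (v x * entry I A 0 + entry I P (v j)) then 1 else 0 := by
  rw [outside, eval, eval_table hx h, eval, eval]
  congr 1
  refine Finset.sum_congr rfl fun i _ => ?_
  rw [eval_eq, eval_table hx (by rwa [Function.update_of_ne hx']),
    eval_table hx (by rwa [Function.update_of_ne hx'])]
  simp [eval, Function.update_of_ne hx', Function.update_of_ne hj]

end Expression

namespace Prog

open Expression

/-- Replace the number `x` by the number `y` at both ends of all edges. -/
def relabelAll : Prog :=
  loop 3 0 0 <| seq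
    (store (leftCell 3) (ite (eq (mem (leftCell 3)) (var 4)) (var 5) (mem (leftCell 3))))
    (store (rightCell 3) (ite (eq (mem (rightCell 3)) (var 4)) (var 5) (mem (rightCell 3))))

/-- Number the blocks of `p` by even numbers and those of `q` by odd ones. -/
def setup : Prog :=
  loop 3 0 0 <| seq
    (store (leftCell 3) (add (table 3 6 1 0 (var 3)) (table 3 6 1 0 (var 3))))
    (store (rightCell 3) (add (add (table 8 11 2 1 (var 3)) (table 8 11 2 1 (var 3))) (lit 1)))

/-- Contract all edges, and count those that are loops when their turn comes. -/
def contract : Prog :=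
  loop 2 0 0 <| bind 4 (mem (leftCell 2)) <| bind 5 (mem (rightCell 2)) <| seq
    (store (lit 0) (add (mem (lit 0)) (eq (var 4) (var 5)))) relabelAll

/-- Count the edges that are not connected to an escaping one.  When all edges are contracted, two
edges are connected if and only if they have the same number. -/
def countUnanchored : Prog :=
  store (lit 0) <| add (mem (lit 0)) <| sum 2 0 0 <| ite
    (sum 3 0 0 (ite (eq (mem (leftCell 2)) (mem (leftCell 3))) (escapes 3) (lit 0)))
    (lit 0) (lit 1)

/-- The test of a pair of partitions. -/
def testPair : Prog := seq setup (seq contract countUnanchored)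

/-- Count, in the memory cell `0`, the violations of the criterion for expansion. -/
def decideExpands : Prog := loop 0 3 1 <| loop 1 8 1 testPair

variable {I : List (List ℕ)} {m v : ℕ → ℕ}

theorem run_relabelAll (z : ℕ) :
    relabelAll.run I v m z =
      if 1 ≤ z ∧ z < 1 + entry I 0 0 + entry I 0 0 then relabel (v 4) (v 5) (m z) else m z := by
  have : ∀ z, relabelAll.run I v m z = if (1 ≤ z ∧ z < 1 + entry I 0 0) ∨
      (1 + entry I 0 0 ≤ z ∧ z < 1 + entry I 0 0 + entry I 0 0) then relabel (v 4) (v 5) (m z)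
      else m z := run_loop
    (fun j m' => ∀ z, m' z = if (1 ≤ z ∧ z < 1 + j) ∨
      (1 + entry I 0 0 ≤ z ∧ z < 1 + entry I 0 0 + j) then relabel (v 4) (v 5) (m z) else m z)
    (fun z => by rw [if_neg (by omega)]) (fun j hj m' hm z => by
      simp only [run, Expression.eval, eval_eq, leftCell, rightCell, Function.update_apply]
      norm_num
      have h1 := hm (1 + j)
      have h2 := hm (1 + entry I 0 0 + j)
      rw [if_neg (by omega)] at h1 h2
      have h3 := hm z
      rw [if_neg (show ¬ entry I 0 0 = 0 by omega), h1, h2, h3]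
      by_cases hz : z = 1 + entry I 0 0 + j
      · subst hz
        rw [if_pos rfl]
        exact Eq.trans rfl (if_pos (by omega)).symm
      · rw [if_neg hz]
        by_cases hz' : z = 1 + j
        · subst hz'
          rw [if_pos rfl]
          exact Eq.trans rfl (if_pos (by omega)).symm
        · rw [if_neg hz']
          congr 1
          apply propext
          omega)
  rw [this]
  congr 1
  apply propext
  omega

theorem run_setup (h0 : v 0 ≤ entry I 3 1) (h1 : v 1 ≤ entry I 8 1) :
    setup.run I v m 0 = m 0 ∧ ∀ j < entry I 0 0,
      setup.run I v m (1 + j) = 2 * entry I 6 (v 0 * entry I 3 0 + entry I 1 j) ∧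
      setup.run I v m (1 + entry I 0 0 + j) =
        2 * entry I 11 (v 1 * entry I 8 0 + entry I 2 j) + 1 := by
  refine run_loop
    (fun i m' => m' 0 = m 0 ∧ ∀ j < i,
      m' (1 + j) = 2 * entry I 6 (v 0 * entry I 3 0 + entry I 1 j) ∧
      m' (1 + entry I 0 0 + j) = 2 * entry I 11 (v 1 * entry I 8 0 + entry I 2 j) + 1)
    ⟨rfl, fun j hj => absurd hj (by omega)⟩ ?_
  rintro i hi m' ⟨hm0, hm⟩
  have e0 : Function.update v 3 i 0 = v 0 := Function.update_of_ne (by norm_num) _ _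
  have e1 : Function.update v 3 i 1 = v 1 := Function.update_of_ne (by norm_num) _ _
  simp only [run, Expression.eval, leftCell, rightCell,
    eval_table (v := Function.update v 3 i) (x := 0) (A := 3) (by norm_num) (e0 ▸ h0),
    eval_table (v := Function.update v 3 i) (x := 1) (A := 8) (by norm_num) (e1 ▸ h1),
    Function.update_self, e0, e1]
  simp only [Function.update_apply]
  refine ⟨?_, fun j hj => ⟨?_, ?_⟩⟩
  · rw [if_neg (by omega), if_neg (by omega), hm0]
  · rw [if_neg (by omega)]
    by_cases hij : j = i
    · subst hij
      rw [if_pos rfl]; ring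
    · rw [if_neg (by omega), (hm j (by omega)).1]
  · by_cases hij : j = i
    · subst hij
      rw [if_pos rfl]; ring
    · rw [if_neg (by omega), if_neg (by omega), (hm j (by omega)).2]

/-- The number of loops met and the numbering after all contractions decide acyclicity and
anchoring of the multigraph stored in the memory. -/
theorem run_contract {k : ℕ} (hk : entry I 0 0 = k) {m' : ℕ → ℕ} (hm' : contract.run I v m = m') :
    (m' 0 = 0 ↔ m 0 = 0 ∧
      IsForestFrom (fun j => m (1 + j)) (fun j => m (1 + k + j)) k 0) ∧
    ∀ S : ℕ → Prop, (∀ i < k, ∃ j < k, m' (1 + i) = m' (1 + j) ∧ S j) ↔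
      IsAnchoredFrom (fun j => m (1 + j)) (fun j => m (1 + k + j)) S k 0 := by
  have : (m' 0 = 0 ∧ IsForestFrom (fun j => m' (1 + j)) (fun j => m' (1 + k + j)) k
        (entry I 0 0) ↔
        m 0 = 0 ∧ IsForestFrom (fun j => m (1 + j)) (fun j => m (1 + k + j)) k 0) ∧
      ∀ S : ℕ → Prop,
        IsAnchoredFrom (fun j => m' (1 + j)) (fun j => m' (1 + k + j)) S k (entry I 0 0) ↔
        IsAnchoredFrom (fun j => m (1 + j)) (fun j => m (1 + k + j)) S k 0 := hm' ▸ run_loop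
    (fun i m' =>
      (m' 0 = 0 ∧ IsForestFrom (fun j => m' (1 + j)) (fun j => m' (1 + k + j)) k i ↔
        m 0 = 0 ∧ IsForestFrom (fun j => m (1 + j)) (fun j => m (1 + k + j)) k 0) ∧
      ∀ S : ℕ → Prop, IsAnchoredFrom (fun j => m' (1 + j)) (fun j => m' (1 + k + j)) S k i ↔
        IsAnchoredFrom (fun j => m (1 + j)) (fun j => m (1 + k + j)) S k 0)
    ⟨Iff.rfl, fun _ => Iff.rfl⟩ (by
      rintro i hi m₁ ⟨hf, ha⟩
      rw [hk] at hi
      rw [isForestFrom_iff_relabel hi] at hf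
      simp only [isAnchoredFrom_iff_relabel hi] at ha
      generalize hm₂ : Prog.run I _ _ _ = m₂
      have e : ∀ z, m₂ z = if 1 ≤ z ∧ z < 1 + k + k then
          relabel (m₁ (1 + i)) (m₁ (1 + k + i)) (m₁ z) else
          if z = 0 then m₁ 0 + (if m₁ (1 + i) = m₁ (1 + k + i) then 1 else 0) else m₁ z := by
        intro z
        rw [← hm₂]
        simp only [run, run_relabelAll, Expression.eval, eval_eq, leftCell, rightCell]
        simp only [Function.update_apply]
        norm_num
        have hk' : entry I 0 0 = k := hk
        simp only [entry] at hk' ⊢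
        simp only [hk']
        split_ifs <;> first | rfl | omega
      have e0 : m₂ 0 = 0 ↔ m₁ 0 = 0 ∧ m₁ (1 + i) ≠ m₁ (1 + k + i) := by
        rw [e, if_neg (by omega), if_pos rfl]
        split_ifs with h <;> simp [h]
      have eA : ∀ j < k, m₂ (1 + j) = relabel (m₁ (1 + i)) (m₁ (1 + k + i)) (m₁ (1 + j)) :=
        fun j hj => by rw [e, if_pos (by omega)]
      have eB : ∀ j < k, m₂ (1 + k + j) =
          relabel (m₁ (1 + i)) (m₁ (1 + k + i)) (m₁ (1 + k + j)) :=
        fun j hj => by rw [e, if_pos (by omega)]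
      refine ⟨?_, fun S => ?_⟩
      · rw [← hf, IsForestFrom.congr eA eB, e0, and_assoc]
      · rw [← ha, IsAnchoredFrom.congr eA eB])
  rw [hk] at this
  simp only [isForestFrom_self, and_true, isAnchoredFrom_self_iff] at this
  exact this

theorem run_countUnanchored {k : ℕ} (hk : entry I 0 0 = k) :
    countUnanchored.run I v m 0 = 0 ↔ m 0 = 0 ∧ ∀ i < k, ∃ j < k, m (1 + i) = m (1 + j) ∧
      (escapes 3).eval I m (Function.update (Function.update v 2 i) 3 j) ≠ 0 := by
  simp only [countUnanchored, run, Expression.eval, eval_eq, leftCell, Function.update_self, hk,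
    Function.update_of_ne (show (2 : ℕ) ≠ 3 by norm_num), add_eq_zero, Finset.sum_eq_zero_iff,
    Finset.mem_range]
  refine and_congr_right fun _ => forall_congr' fun i => forall_congr' fun _ => ?_
  rw [ite_eq_left_iff]
  simp only [one_ne_zero, imp_false, not_not, ne_eq, Finset.sum_eq_zero_iff, Finset.mem_range]
  push Not
  refine exists_congr fun j => and_congr_right fun _ => ?_
  by_cases h : m (1 + i) = m (1 + j) <;> simp [h]

/-- The escape test, in terms of the entries of the input. -/
def escapesValue (I : List (List ℕ)) (r r' j : ℕ) : ℕ :=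
  entry I 5 (entry I 1 j) + entry I 9 (entry I 2 j) +
    ((entry I 7 (r * entry I 3 0 + entry I 1 j) - ∑ i ∈ Finset.range (entry I 0 0),
      if entry I 6 (r * entry I 3 0 + entry I 1 i) = entry I 6 (r * entry I 3 0 + entry I 1 j)
      then 1 else 0) +
    (entry I 12 (r' * entry I 8 0 + entry I 2 j) - ∑ i ∈ Finset.range (entry I 0 0),
      if entry I 11 (r' * entry I 8 0 + entry I 2 i) =
        entry I 11 (r' * entry I 8 0 + entry I 2 j) then 1 else 0))

theorem run_testPair (h0 : v 0 ≤ entry I 3 1) (h1 : v 1 ≤ entry I 8 1) {k : ℕ}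
    (hk : entry I 0 0 = k) {A B : ℕ → ℕ}
    (hA : ∀ j < k, 2 * entry I 6 (v 0 * entry I 3 0 + entry I 1 j) = A j)
    (hB : ∀ j < k, 2 * entry I 11 (v 1 * entry I 8 0 + entry I 2 j) + 1 = B j) :
    testPair.run I v m 0 = 0 ↔ m 0 = 0 ∧ IsForestFrom A B k 0 ∧
      IsAnchoredFrom A B (fun j => escapesValue I (v 0) (v 1) j ≠ 0) k 0 := by
  rw [testPair, run, run, run_countUnanchored hk, (run_contract hk rfl).1]
  obtain ⟨hs, hs'⟩ := run_setup (m := m) h0 h1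
  rw [hk] at hs'
  have eA : ∀ j < k, setup.run I v m (1 + j) = A j := fun j hj => (hs' j hj).1.trans (hA j hj)
  have eB : ∀ j < k, setup.run I v m (1 + k + j) = B j :=
    fun j hj => (hs' j hj).2.trans (hB j hj)
  have esc : ∀ m i j, (escapes 3).eval I m (Function.update (Function.update v 2 i) 3 j) =
      escapesValue I (v 0) (v 1) j := by
    intro m i j
    have e0 : Function.update (Function.update v 2 i) 3 j 0 = v 0 := by simp
    have e1 : Function.update (Function.update v 2 i) 3 j 1 = v 1 := by simp
    simp only [escapes, Expression.eval,
      eval_outside (v := Function.update (Function.update v 2 i) 3 j) (x := 0) (A := 3) (j := 3)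
        (by norm_num) (by norm_num) (by norm_num) (e0 ▸ h0),
      eval_outside (v := Function.update (Function.update v 2 i) 3 j) (x := 1) (A := 8) (j := 3)
        (by norm_num) (by norm_num) (by norm_num) (e1 ▸ h1), Function.update_self, e0, e1]
    rfl
  simp only [esc]
  rw [(run_contract hk rfl).2, hs, IsForestFrom.congr eA eB, IsAnchoredFrom.congr eA eB, and_assoc]

theorem run_decideExpands {P : ℕ → ℕ → Prop}
    (hP : ∀ r < entry I 3 1, ∀ r' < entry I 8 1, ∀ v m, v 0 = r → v 1 = r' →
      (testPair.run I v m 0 = 0 ↔ m 0 = 0 ∧ P r r')) :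
    decideExpands.run I (fun _ => 0) (fun _ => 0) 0 = 0 ↔
      ∀ r < entry I 3 1, ∀ r' < entry I 8 1, P r r' := by
  refine run_loop (fun n m => m 0 = 0 ↔ ∀ r < n, ∀ r' < entry I 8 1, P r r')
    (by simp) fun r hr m hm => ?_
  have : (loop 1 8 1 testPair).run I (Function.update (fun _ => 0) 0 r) m 0 = 0 ↔
      m 0 = 0 ∧ ∀ r' < entry I 8 1, P r r' := by
    refine run_loop (fun n m' => m' 0 = 0 ↔ m 0 = 0 ∧ ∀ r' < n, P r r') (by simp)
      fun r' hr' m' hm' => ?_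
    rw [hP r hr r' hr' _ _ (by simp) (by simp), hm',
      Nat.forall_lt_succ_right, and_assoc]
  rw [this, hm, Nat.forall_lt_succ_right]

theorem loopsLE_decideExpands {N : ℕ} (h0 : entry I 0 0 ≤ N) (h1 : entry I 3 1 ≤ N)
    (h2 : entry I 8 1 ≤ N) : decideExpands.LoopsLE I N := by
  simp [decideExpands, testPair, setup, contract, countUnanchored, relabelAll, LoopsLE,
    Expression.LoopsLE, leftCell, rightCell, table, rowStart, Expression.eq, escapes, outside,
    h0, h1, h2]

end Prog

/-! ### The tables as inputs of the program -/

namespace Tabulation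

variable {V L V' L' : Type*} {M : MStr V L} {M' : MStr V' L'}

theorem getD_ofFn {n : ℕ} (f : Fin n → ℕ) (i : Fin n) : (List.ofFn f).getD i 0 = f i := by
  simp [List.getD_eq_getElem?_getD]

theorem getD_ofFn_table {a n : ℕ} (f : Fin a → Fin n → ℕ) (r : Fin a) (x : Fin n) :
    (List.ofFn fun z : Fin (a * n) => f z.divNat z.modNat).getD (r * n + x) 0 = f r x := by
  have h := getD_ofFn (fun z : Fin (a * n) => f z.divNat z.modNat) (Fin.mkDivMod r x)
  rw [Fin.divNat_mkDivMod, Fin.modNat_mkDivMod] at h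
  rwa [Fin.coe_mkDivMod, mul_comm n] at h

variable (T : Tabulation M) (T' : Tabulation M') (X : Interface M M')

/-- The block of a border vertex contains a vertex outside the interface if and only if it has more
elements than the interface has in it. -/
theorem blockSize_sub_sum_ne_zero_iff {k : ℕ} {c : Fin k → M.border} (hc : Function.Injective c)
    (r : Fin T.a) (j : Fin k) {e : ℕ → ℕ}
    (he : ∀ i : Fin k, e i = T.label r (T.vertex.symm (c i))) :
    (T.blockSize r (T.vertex.symm (c j)) -
        ∑ i ∈ Finset.range k, if e i = e j then 1 else 0) ≠ 0 ↔
      ∃ y, y ∉ Set.range c ∧ (T.row r).1 (c j) y := by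
  classical
  have hfin : Finite M.border := Finite.of_equiv _ T.vertex
  let f : {i : Fin k // (T.row r).1 (c j) (c i)} → {y : M.border // (T.row r).1 (c j) y} :=
    fun i => ⟨c i, i.2⟩
  have hf : Function.Injective f := fun i i' h => Subtype.ext (hc (congrArg Subtype.val h))
  have hsum : (∑ i ∈ Finset.range k, if e i = e j then 1 else 0) =
      Nat.card {i : Fin k // (T.row r).1 (c j) (c i)} := by
    rw [Finset.sum_range, Nat.card_eq_fintype_card, Fintype.card_subtype,
      Finset.card_filter]
    refine Finset.sum_congr rfl fun i _ => ?_
    congr 1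
    rw [he, he, Fin.val_inj, T.label_eq_iff, T.vertex.apply_symm_apply, T.vertex.apply_symm_apply]
    exact propext ⟨fun h => (T.row r).1.symm h, fun h => (T.row r).1.symm h⟩
  rw [hsum, blockSize, T.vertex.apply_symm_apply]
  have hle := Nat.card_le_card_of_injective f hf
  constructor
  · intro h
    by_contra! hno
    have hsurj : Function.Surjective f := by
      rintro ⟨y, hy⟩
      by_cases hyc : y ∈ Set.range c
      · obtain ⟨i, rfl⟩ := hyc
        exact ⟨⟨i, hy⟩, rfl⟩
      · exact absurd hy (hno y hyc)
    exact h (by rw [Nat.card_eq_of_bijective f ⟨hf, hsurj⟩, Nat.sub_self])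
  · rintro ⟨y, hyc, hy⟩ h
    have hcard : Nat.card {i : Fin k // (T.row r).1 (c j) (c i)} =
        Nat.card {y : M.border // (T.row r).1 (c j) y} := by omega
    obtain ⟨⟨i, hi⟩, hiy⟩ := ((Nat.bijective_iff_injective_and_card f).2 ⟨hf, hcard⟩).2 ⟨y, hy⟩
    exact hyc ⟨i, congrArg Subtype.val hiy⟩

theorem entry_k : entry (input T T' X) 0 0 = X.k := rfl

theorem entry_left (j : Fin X.k) : entry (input T T' X) 1 j = T.vertex.symm (X.left' j) :=
  getD_ofFn _ j

theorem entry_right (j : Fin X.k) : entry (input T T' X) 2 j = T'.vertex.symm (X.right' j) :=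
  getD_ofFn _ j

theorem entry_outputs (x : Fin T.n) :
    entry (input T T' X) 5 x ≠ 0 ↔ (T.vertex x : V) ∈ M.outputs := by
  classical
  refine Iff.trans (Eq.to_iff (congrArg (· ≠ 0) (getD_ofFn _ x))) ?_
  simp

theorem entry_inputs (x : Fin T'.n) :
    entry (input T T' X) 9 x ≠ 0 ↔ (T'.vertex x : V') ∈ M'.inputs := by
  classical
  refine Iff.trans (Eq.to_iff (congrArg (· ≠ 0) (getD_ofFn _ x))) ?_
  simp

theorem entry_label_left (r : Fin T.a) (j : Fin X.k) :
    entry (input T T' X) 6 (r * entry (input T T' X) 3 0 + entry (input T T' X) 1 j) =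
      T.label r (T.vertex.symm (X.left' j)) := by
  rw [entry_left]
  exact getD_ofFn_table (fun r x => (T.label r x : ℕ)) _ _

theorem entry_size_left (r : Fin T.a) (j : Fin X.k) :
    entry (input T T' X) 7 (r * entry (input T T' X) 3 0 + entry (input T T' X) 1 j) =
      T.blockSize r (T.vertex.symm (X.left' j)) := by
  rw [entry_left]
  exact getD_ofFn_table T.blockSize _ _

theorem entry_label_right (r : Fin T'.a) (j : Fin X.k) :
    entry (input T T' X) 11 (r * entry (input T T' X) 8 0 + entry (input T T' X) 2 j) =
      T'.label r (T'.vertex.symm (X.right' j)) := by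
  rw [entry_right]
  exact getD_ofFn_table (fun r x => (T'.label r x : ℕ)) _ _

theorem entry_size_right (r : Fin T'.a) (j : Fin X.k) :
    entry (input T T' X) 12 (r * entry (input T T' X) 8 0 + entry (input T T' X) 2 j) =
      T'.blockSize r (T'.vertex.symm (X.right' j)) := by
  rw [entry_right]
  exact getD_ofFn_table T'.blockSize _ _

theorem escapesValue_ne_zero_iff (r : Fin T.a) (r' : Fin T'.a) (j : Fin X.k) :
    Prog.escapesValue (input T T' X) r r' j ≠ 0 ↔ X.Escapes (T.row r).1 (T'.row r').1 j := by
  have hl : Function.Injective X.left' := fun i i' h => X.g.injective (congrArg Subtype.val h)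
  have hr : Function.Injective X.right' := fun i i' h => X.h.injective (congrArg Subtype.val h)
  have hl' : ∀ y, y ∉ Set.range X.left' ↔ (y : V) ∉ Set.range X.g := fun y =>
    not_congr ⟨fun ⟨j, hj⟩ => ⟨j, congrArg Subtype.val hj⟩, fun ⟨j, hj⟩ => ⟨j, Subtype.ext hj⟩⟩
  have hr' : ∀ y, y ∉ Set.range X.right' ↔ (y : V') ∉ Set.range X.h := fun y =>
    not_congr ⟨fun ⟨j, hj⟩ => ⟨j, congrArg Subtype.val hj⟩, fun ⟨j, hj⟩ => ⟨j, Subtype.ext hj⟩⟩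
  have h1 := entry_outputs T T' X (T.vertex.symm (X.left' j))
  have h2 := entry_inputs T T' X (T'.vertex.symm (X.right' j))
  have h3 := T.blockSize_sub_sum_ne_zero_iff hl r j (e := fun j =>
    entry (input T T' X) 6 (r * entry (input T T' X) 3 0 + entry (input T T' X) 1 j))
    (entry_label_left T T' X r)
  have h4 := T'.blockSize_sub_sum_ne_zero_iff hr r' j (e := fun j =>
    entry (input T T' X) 11 (r' * entry (input T T' X) 8 0 + entry (input T T' X) 2 j))
    (entry_label_right T T' X r')
  simp only [hl', hr', Equiv.apply_symm_apply] at h1 h2 h3 h4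
  rw [Interface.Escapes, ← h3, ← h4, Prog.escapesValue, entry_size_left, entry_size_right,
    entry_k]
  change _ ↔ X.g j ∈ M.outputs ∨ X.h j ∈ M'.inputs ∨ _
  change _ ↔ X.g j ∈ M.outputs at h1
  change _ ↔ X.h j ∈ M'.inputs at h2
  rw [← h1, ← h2, ← entry_left T T' X, ← entry_right T T' X]
  simp only [ne_eq, add_eq_zero, not_and_or, or_assoc]

theorem run_testPair_iff (r : Fin T.a) (r' : Fin T'.a) {v m : ℕ → ℕ} (h0 : v 0 = r)
    (h1 : v 1 = r') :
    Prog.testPair.run (input T T' X) v m 0 = 0 ↔ m 0 = 0 ∧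
      WeakOrth (X.restrictLeft (T.row r).1) (X.restrictRight (T'.row r').1) ∧
        X.Anchored (T.row r).1 (T'.row r').1 := by
  rw [Prog.run_testPair (I := input T T' X) (h0 ▸ r.2.le) (h1 ▸ r'.2.le) (entry_k T T' X)
    (fun _ _ => rfl) (fun _ _ => rfl), h0, h1]
  have hA : ∀ i j : Fin X.k,
      2 * entry (input T T' X) 6 (r * entry (input T T' X) 3 0 + entry (input T T' X) 1 i) =
        2 * entry (input T T' X) 6 (r * entry (input T T' X) 3 0 + entry (input T T' X) 1 j) ↔
      X.restrictLeft (T.row r).1 i j := fun i j => by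
    rw [entry_label_left, entry_label_left, Nat.mul_right_inj two_ne_zero, Fin.val_inj,
      T.label_eq_iff, T.vertex.apply_symm_apply, T.vertex.apply_symm_apply]
    rfl
  have hB : ∀ i j : Fin X.k,
      2 * entry (input T T' X) 11
          (r' * entry (input T T' X) 8 0 + entry (input T T' X) 2 i) + 1 =
        2 * entry (input T T' X) 11
          (r' * entry (input T T' X) 8 0 + entry (input T T' X) 2 j) + 1 ↔
      X.restrictRight (T'.row r').1 i j := fun i j => by
    rw [entry_label_right, entry_label_right, Nat.add_right_cancel_iff,
      Nat.mul_right_inj two_ne_zero, Fin.val_inj,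
      T'.label_eq_iff, T'.vertex.apply_symm_apply, T'.vertex.apply_symm_apply]
    rfl
  -- The numbers of the ends of the edges: even for the blocks of `p`, odd for those of `q`.
  let A : ℕ → ℕ := fun j =>
    2 * entry (input T T' X) 6 (r * entry (input T T' X) 3 0 + entry (input T T' X) 1 j)
  let B : ℕ → ℕ := fun j =>
    2 * entry (input T T' X) 11 (r' * entry (input T T' X) 8 0 + entry (input T T' X) 2 j) + 1
  have hAB : ∀ i j : Fin X.k, A i ≠ B j := fun i j => by simp only [A, B]; omega
  rw [X.anchored_iff, weakOrth_iff_isForestFrom (A := A) (B := B) hA hB hAB,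
    forall_invariant_iff_isAnchoredFrom (A := A) (B := B) hA hB hAB
      (S' := fun j => Prog.escapesValue (input T T' X) r r' j ≠ 0)
      (escapesValue_ne_zero_iff T T' X r r')]

theorem run_decideExpands_iff [Finite V] [Finite L] [Finite V'] [Finite L']
    (hM : M.IsComponent) (hM' : M'.IsComponent) :
    Prog.decideExpands.run (input T T' X) (fun _ => 0) (fun _ => 0) 0 = 0 ↔ X.Expands := by
  rw [Prog.run_decideExpands (I := input T T' X)
    (P := fun r r' => ∀ (hr : r < T.a) (hr' : r' < T'.a),
      WeakOrth (X.restrictLeft (T.row ⟨r, hr⟩).1) (X.restrictRight (T'.row ⟨r', hr'⟩).1) ∧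
        X.Anchored (T.row ⟨r, hr⟩).1 (T'.row ⟨r', hr'⟩).1)
    (fun r (hr : r < T.a) r' (hr' : r' < T'.a) v m h0 h1 => by
      rw [run_testPair_iff T T' X ⟨r, hr⟩ ⟨r', hr'⟩ h0 h1]
      exact and_congr_right fun _ => ⟨fun h _ _ => h, fun h => h hr hr'⟩),
    X.expands_iff hM hM']
  constructor
  · intro h p hp q hq
    obtain ⟨r, hr⟩ := T.row.surjective ⟨p, hp⟩
    obtain ⟨r', hr'⟩ := T'.row.surjective ⟨q, hq⟩
    have := h r r.2 r' r'.2 r.2 r'.2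
    rwa [Fin.eta, Fin.eta, hr, hr'] at this
  · exact fun h r _ r' _ hr hr' => h _ (T.row ⟨r, hr⟩).2 _ (T'.row ⟨r', hr'⟩).2

theorem a_eq_ncard : T.a = M.beh.ncard := by
  rw [← Nat.card_coe_set_eq, ← Nat.card_congr T.row, Nat.card_fin]

end Tabulation

theorem mainTheorem5 :
    -- one program and one polynomial for all components
    (∃ (P : Cmd) (f : Polynomial ℕ),
      ∀ {V L V' L' : Type*} [Finite V] [Finite L] [Finite V'] [Finite L']
        (M : MStr V L) (M' : MStr V' L'), M.IsComponent → M'.IsComponent →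
        ∀ (X : Interface M M') (T : Tabulation M) (T' : Tabulation M'),
          DecidesWithin P (Tabulation.input T T' X)
            (f.eval (M'.outputs.ncard + M'.beh.ncard + M.beh.ncard)) X.Expands) ∧
    -- the reduction to pairwise tests on graphs of linear size
    (∀ {V L V' L' : Type*} [Finite V] [Finite L] [Finite V'] [Finite L']
        (M : MStr V L) (M' : MStr V' L'), M.IsComponent → M'.IsComponent →
        ∀ X : Interface M M',
          (X.Expands ↔ ∀ p ∈ M.beh, ∀ q ∈ M'.beh,
            WeakOrth (X.restrictLeft p) (X.restrictRight q) ∧ X.Anchored p q) ∧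
          (∀ p ∈ M.beh, ∀ q ∈ M'.beh,
            (X.restrictedGraph p q).size ≤ 3 * M'.outputs.ncard)) := by
  refine ⟨⟨Prog.decideExpands.decider, Prog.decideExpands.cost + 4, ?_⟩, ?_⟩
  · intro V L V' L' _ _ _ _ M M' hM hM' X T T'
    refine Prog.decidesWithin (Prog.loopsLE_decideExpands ?_ ?_ ?_)
      (Tabulation.run_decideExpands_iff T T' X hM hM')
    · have : entry (Tabulation.input T T' X) 0 0 = X.k := rfl
      have := X.k_le_ncard_outputs
      omega
    · have : entry (Tabulation.input T T' X) 3 1 = T.a := rfl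
      have := T.a_eq_ncard
      omega
    · have : entry (Tabulation.input T T' X) 8 1 = T'.a := rfl
      have := T'.a_eq_ncard
      omega
  · intro V L V' L' _ _ _ _ M M' hM hM' X
    exact ⟨X.expands_iff hM hM', fun p _ q _ => X.size_restrictedGraph_le p q⟩
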